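/- **Setting.** Let $V=\mathbb{Z}^3$ be the integer lattice graph ($x\sim y$ iff $\sum_{i=1}^3|x_i-y_i|=1$), with counting measure $\mu$. For $u,v:V\to\mathbb{R}$ put $\Delta u(x)=\sum_{y\sim x}(u(y)-u(x))$, $\nabla u\nabla v(x)=\frac12\sum_{y\sim x}(u(y)-u(x))(v(y)-v(x))$ and $|\nabla u|^2=\nabla u\nabla u$. Let $H^1(V)$ be the completion of the finitely supported functions under $\|u\|_{H^1}^2=\int_V(|\nabla u|^2+u^2)\,d\mu$. Let $a,b>0$, $p>6$ and let $h:V\to\mathbb{R}$ satisfy - $(h_1)$ $h\ge 0$, and $\Omega=\{x\in V:h(x)=0\}$ is a connected (in particular nonempty) and bounded subset of the graph $\mathbb Z^3$ containing at least two points; - $(h_2)$ there is $M>0$ such that $\{x\in V:h(x)<M\}$ is finite. For $\lambda>0$ let $\mathcal H_\lambda=\{u\in H^1(V):\int_V\lambda h u^2\,d\mu<\infty\}$ with norm $\|u\|_{\mathcal H_\lambda}^2=\int_V\big(a|\nabla u|^2+(\lambda h+1)u^2\big)\,d\mu$. Consider the equation $$-\Big(a+b\int_V|\nabla u|^2\,d\mu\Big)\Delta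 u+(\lambda h+1)u=|u|^{p-2}u\log u^2\quad\text{on }V \tag{$*$}$$ and the functional on $\mathcal H_\lambda$ $$J_\lambda(u)=\tfrac12\|u\|_{\mathcal H_\lambda}^2+\tfrac b4\Big(\int_V|\nabla u|^2d\mu\Big)^2+\tfrac2{p^2}\int_V|u|^p\,d\mu-\tfrac1p\int_V|u|^p\log u^2\,d\mu,$$ where terms with $u(x)=0$ in the logarithmic expressions are $0$. Its derivative is $$(J_\lambda'(u),\varphi)=\int_V\big(a\nabla u\nabla\varphi+(\lambda h+1)u\varphi\big)d\mu+b\int_V|\nabla u|^2d\mu\int_V\nabla u\nabla\varphi\,d\mu-\int_V|u|^{p-2}u\varphi\log u^2\,d\mu .$$ A weak solution of $(*)$ is a critical point $u\in\mathcal H_\lambda$ of $J_\lambda$. It is sign-changing if $u^+=\max\{u,0\}\not\equiv0$ and $u^-=\min\{u,0\}\not\equiv0$. A least energy sign-changing solution is one whose energy $J_\lambda$ is minimal among all sign-changing solutions. Let $$\mathcal N_\lambda=\{u\in\mathcal H_\lambda\setminus\{0\}:(J_\lambda'(u),u)=0\},\qquad c_\lambda=\inf_{\mathcal N_\lambda}J_\lambda,$$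 $$\mathcal M_\lambda=\{u\in\mathcal H_\lambda:u^\pm\not\equiv0,\ (J_\lambda'(u),u^+)=(J_\lambda'(u),u^-)=0\},\qquad m_\lambda=\inf_{\mathcal M_\lambda}J_\lambda .$$ **Theorem.** There is $\lambda_0>0$ such that for every $\lambda\ge\lambda_0$: equation $(*)$ has a least energy sign-changing solution $u_\lambda\in\mathcal H_\lambda$; moreover $u_\lambda\in\mathcal M_\lambda$ and $J_\lambda(u_\lambda)=m_\lambda$. The infima $c_\lambda$ and $m_\lambda$ are finite (taken over nonempty sets on which $J_\lambda$ is bounded below), and $m_\lambda>2c_\lambda$. -/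

import Mathlib

namespace LogKirchhoff

noncomputable section

/-- The vertex set of the lattice graph. -/
abbrev V : Type := Fin 3 → ℤ

/-- The integer lattice graph: `x` and `y` are neighbours iff `∑ i, |x i - y i| = 1`. -/
def lattice : SimpleGraph V where
  Adj x y := ∑ i, |x i - y i| = 1
  symm := ⟨fun x y hxy => by
    rw [← hxy]
    exact Finset.sum_congr rfl fun i _ => abs_sub_comm _ _⟩
  loopless := ⟨fun x hx => by simp at hx⟩

/-- The six neighbours of a vertex, as a finite set (see `mem_nbrs`). -/
def nbrs (x : V) : Finset V :=
  Finset.univ.image (fun i : Fin 3 => x + Pi.single i 1) ∪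
    Finset.univ.image (fun i : Fin 3 => x - Pi.single i 1)

theorem mem_nbrs (x y : V) : y ∈ nbrs x ↔ lattice.Adj x y := by
  simp only [nbrs, lattice, Finset.mem_union, Finset.mem_image, Finset.mem_univ, true_and,
    Fin.sum_univ_three, Fin.exists_fin_succ, IsEmpty.exists_iff, or_false]
  simp only [funext_iff, Fin.forall_fin_succ, IsEmpty.forall_iff, and_true]
  simp
  have e : ∀ z : ℤ, |z| = max z (-z) := fun z => rfl
  rw [e, e, e]
  simp
  omega

/-- The gradient form `∇u∇v (x) = ½ ∑_{y ∼ x} (u y - u x) (v y - v x)`. -/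
def gradForm (u v : V → ℝ) (x : V) : ℝ :=
  (1 / 2) * ∑ y ∈ nbrs x, (u y - u x) * (v y - v x)

/-- `∫ ∇u∇v dμ`, with `μ` the counting measure. -/
def gradInt (u v : V → ℝ) : ℝ := ∑' x, gradForm u v x

/-- The space `H¹(ℤ³)`, realised as a space of functions: those of finite `H¹` norm.
It is the completion of the finitely supported functions by `exists_finite_support_near`. -/
def H1 : Set (V → ℝ) := {u | Summable fun x => gradForm u u x + u x ^ 2}

/-- The square of the `H¹` norm. -/
def h1NormSq (u : V → ℝ) : ℝ := ∑' x, (gradForm u u x + u x ^ 2)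

/-- `ℋ_λ`: the functions `u ∈ H¹(ℤ³)` with `∫ λ h u² dμ < ∞`. -/
def HSpace (h : V → ℝ) (lam : ℝ) : Set (V → ℝ) :=
  {u | u ∈ H1 ∧ Summable fun x => lam * h x * u x ^ 2}

/-- The norm of `ℋ_λ`. -/
def hNorm (a : ℝ) (h : V → ℝ) (lam : ℝ) (u : V → ℝ) : ℝ :=
  Real.sqrt (∑' x, (a * gradForm u u x + (lam * h x + 1) * u x ^ 2))

/-- The energy functional `J_λ`. -/
def J (a b p : ℝ) (h : V → ℝ) (lam : ℝ) (u : V → ℝ) : ℝ :=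
  (1 / 2) * ∑' x, (a * gradForm u u x + (lam * h x + 1) * u x ^ 2)
    + (b / 4) * gradInt u u ^ 2
    + (2 / p ^ 2) * ∑' x, |u x| ^ p
    - (1 / p) * ∑' x, |u x| ^ p * Real.log (u x ^ 2)

/-- The pairing `(J_λ'(u), φ)`. -/
def dJ (a b p : ℝ) (h : V → ℝ) (lam : ℝ) (u φ : V → ℝ) : ℝ :=
  ∑' x, (a * gradForm u φ x + (lam * h x + 1) * u x * φ x)
    + b * gradInt u u * gradInt u φ
    - ∑' x, |u x| ^ (p - 2) * u x * φ x * Real.log (u x ^ 2)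

/-- `u` is a critical point of `J_λ` on `ℋ_λ`: the Fréchet derivative of `J_λ` at `u`, with
respect to the norm of `ℋ_λ`, exists and is zero. -/
def IsCriticalPoint (a b p : ℝ) (h : V → ℝ) (lam : ℝ) (u : V → ℝ) : Prop :=
  ∀ ε > 0, ∃ δ > 0, ∀ φ ∈ HSpace h lam, hNorm a h lam φ < δ →
    |J a b p h lam (u + φ) - J a b p h lam u| ≤ ε * hNorm a h lam φ

/-- Weak solutions of
`-(a + b ∫ |∇u|² dμ) Δu + (λ h + 1) u = |u|^(p-2) u log u²` on `ℤ³`: critical points of `J_λ`. -/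
def IsWeakSolution (a b p : ℝ) (h : V → ℝ) (lam : ℝ) (u : V → ℝ) : Prop :=
  u ∈ HSpace h lam ∧ IsCriticalPoint a b p h lam u

/-- `u⁺ = max {u, 0}`. -/
def posPart (u : V → ℝ) : V → ℝ := fun x => max (u x) 0

/-- `u⁻ = min {u, 0}`. -/
def negPart (u : V → ℝ) : V → ℝ := fun x => min (u x) 0

/-- Sign-changing solutions: weak solutions with `u⁺ ≢ 0` and `u⁻ ≢ 0`. -/
def IsSignChangingSolution (a b p : ℝ) (h : V → ℝ) (lam : ℝ) (u : V → ℝ) : Prop :=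
  IsWeakSolution a b p h lam u ∧ posPart u ≠ 0 ∧ negPart u ≠ 0

/-- The Nehari manifold `𝒩_λ`. -/
def nehari (a b p : ℝ) (h : V → ℝ) (lam : ℝ) : Set (V → ℝ) :=
  {u | u ∈ HSpace h lam ∧ u ≠ 0 ∧ dJ a b p h lam u u = 0}

/-- The sign-changing Nehari set `ℳ_λ`. -/
def signNehari (a b p : ℝ) (h : V → ℝ) (lam : ℝ) : Set (V → ℝ) :=
  {u | u ∈ HSpace h lam ∧ posPart u ≠ 0 ∧ negPart u ≠ 0 ∧
    dJ a b p h lam u (posPart u) = 0 ∧ dJ a b p h lam u (negPart u) = 0}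

/-- `c_λ`, the infimum of `J_λ` over `𝒩_λ`. -/
def cLevel (a b p : ℝ) (h : V → ℝ) (lam : ℝ) : ℝ :=
  sInf (J a b p h lam '' nehari a b p h lam)

/-- `m_λ`, the infimum of `J_λ` over `ℳ_λ`. -/
def mLevel (a b p : ℝ) (h : V → ℝ) (lam : ℝ) : ℝ :=
  sInf (J a b p h lam '' signNehari a b p h lam)

/-- The potential well `Ω = {h = 0}`. -/
def well (h : V → ℝ) : Set V := {x | h x = 0}

theorem gradForm_self_nonneg (u : V → ℝ) (x : V) : 0 ≤ gradForm u u x := by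
  unfold gradForm
  have : 0 ≤ ∑ y ∈ nbrs x, (u y - u x) * (u y - u x) :=
    Finset.sum_nonneg fun y _ => mul_self_nonneg _
  positivity

theorem gradForm_self_le (u : V → ℝ) (x : V) :
    gradForm u u x ≤ ∑ i : Fin 3,
      (u (x + Pi.single i 1) ^ 2 + u (x - Pi.single i 1) ^ 2) + 6 * u x ^ 2 := by
  have key : ∑ y ∈ nbrs x, (u y - u x) * (u y - u x) ≤
      ∑ i : Fin 3, ((u (x + Pi.single i 1) - u x) ^ 2 + (u (x - Pi.single i 1) - u x) ^ 2) := by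
    have img : ∀ g : Fin 3 → V, ∑ y ∈ Finset.univ.image g, (u y - u x) * (u y - u x) ≤
        ∑ i : Fin 3, (u (g i) - u x) ^ 2 := by
      intro g
      refine (Finset.sum_image_le_of_nonneg (s := Finset.univ) (g := g)
        (f := fun y => (u y - u x) * (u y - u x)) fun i _ => mul_self_nonneg _).trans
        (Finset.sum_le_sum fun i _ => by simp [sq])
    have hu : ∑ y ∈ nbrs x, (u y - u x) * (u y - u x) ≤
        ∑ y ∈ Finset.univ.image (fun i : Fin 3 => x + Pi.single i 1), (u y - u x) * (u y - u x) +
        ∑ y ∈ Finset.univ.image (fun i : Fin 3 => x - Pi.single i 1),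
          (u y - u x) * (u y - u x) := by
      rw [← Finset.sum_union_inter]
      exact le_add_of_nonneg_right (Finset.sum_nonneg fun i _ => mul_self_nonneg _)
    rw [Finset.sum_add_distrib]
    exact hu.trans (add_le_add (img _) (img _))
  unfold gradForm
  simp only [Fin.sum_univ_three] at key ⊢
  nlinarith [sq_nonneg (u (x + Pi.single 0 1) + u x), sq_nonneg (u (x + Pi.single 1 1) + u x),
    sq_nonneg (u (x + Pi.single 2 1) + u x), sq_nonneg (u (x - Pi.single 0 1) + u x),
    sq_nonneg (u (x - Pi.single 1 1) + u x), sq_nonneg (u (x - Pi.single 2 1) + u x)]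

theorem hasSum_translate {g : V → ℝ} {S : ℝ} (hg : HasSum g S) (e : V) :
    HasSum (fun x => g (x + e) + g (x - e)) (S + S) := by
  have h1 : HasSum (g ∘ Equiv.addRight e) S := (Equiv.hasSum_iff (Equiv.addRight e)).2 hg
  have h2 : HasSum (g ∘ Equiv.subRight e) S := (Equiv.hasSum_iff (Equiv.subRight e)).2 hg
  exact h1.add h2

theorem hasSum_bound {u : V → ℝ} {S : ℝ} (hu : HasSum (fun x => u x ^ 2) S) :
    HasSum (fun x => (∑ i : Fin 3,
      (u (x + Pi.single i 1) ^ 2 + u (x - Pi.single i 1) ^ 2) + 6 * u x ^ 2) + u x ^ 2)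
      (13 * S) := by
  have h3 : HasSum (fun x : V => ∑ i : Fin 3,
      (u (x + Pi.single i 1) ^ 2 + u (x - Pi.single i 1) ^ 2)) (∑ _i : Fin 3, (S + S)) :=
    hasSum_sum fun i _ => hasSum_translate hu (Pi.single i 1)
  have h4 : ∑ _i : Fin 3, (S + S) + 6 * S + S = 13 * S := by
    rw [Fin.sum_univ_three]
    ring
  have h5 := (h3.add (hu.mul_left 6)).add hu
  rwa [h4] at h5

/-- A function with square-summable values is in `H¹(ℤ³)`, with control of the norm. -/
theorem mem_H1_of_hasSum {u : V → ℝ} {S : ℝ} (hu : HasSum (fun x => u x ^ 2) S) :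
    u ∈ H1 ∧ h1NormSq u ≤ 13 * S := by
  have hb := hasSum_bound hu
  have hle : ∀ x, gradForm u u x + u x ^ 2 ≤ (∑ i : Fin 3,
      (u (x + Pi.single i 1) ^ 2 + u (x - Pi.single i 1) ^ 2) + 6 * u x ^ 2) + u x ^ 2 :=
    fun x => by linarith [gradForm_self_le u x]
  have hs : u ∈ H1 := Summable.of_nonneg_of_le
    (fun x => add_nonneg (gradForm_self_nonneg u x) (sq_nonneg _)) hle hb.summable
  exact ⟨hs, (hs.tsum_le_tsum hle hb.summable).trans hb.tsum_eq.le⟩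

/-- The finitely supported functions are dense in `H1` for the `H¹` norm. -/
theorem exists_finite_support_near {u : V → ℝ} (hu : u ∈ H1) {ε : ℝ} (hε : 0 < ε) :
    ∃ v : V → ℝ, (Function.support v).Finite ∧ u - v ∈ H1 ∧ h1NormSq (u - v) < ε := by
  classical
  have h2 : Summable fun x => u x ^ 2 := Summable.of_nonneg_of_le (fun x => sq_nonneg _)
    (fun x => le_add_of_nonneg_left (gradForm_self_nonneg u x)) hu
  obtain ⟨s, hs⟩ := ((tendsto_order.1 h2.hasSum).1 (∑' x, u x ^ 2 - ε / 13)
    (by linarith [show 0 < ε / 13 by positivity])).exists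
  have hw : HasSum (fun x => (u - fun y => if y ∈ s then u y else 0) x ^ 2)
      (∑' x, u x ^ 2 - ∑ x ∈ s, u x ^ 2) := by
    have hf : HasSum (fun x => if x ∈ s then u x ^ 2 else 0) (∑ x ∈ s, u x ^ 2) := by
      have key : HasSum (fun x => if x ∈ s then u x ^ 2 else 0)
          (∑ x ∈ s, if x ∈ s then u x ^ 2 else 0) :=
        hasSum_sum_of_ne_finset_zero fun x hx => by simp [hx]
      rwa [Finset.sum_congr rfl (fun x hx => if_pos hx)] at key
    have hd := h2.hasSum.sub hf
    have e : (fun x => (u - fun y => if y ∈ s then u y else 0) x ^ 2) =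
        fun x => u x ^ 2 - if x ∈ s then u x ^ 2 else 0 := by
      funext x
      by_cases hx : x ∈ s <;> simp [hx]
    rw [e]
    exact hd
  obtain ⟨hm, hle⟩ := mem_H1_of_hasSum hw
  refine ⟨_, s.finite_toSet.subset fun x hx => ?_, hm, by linarith⟩
  by_contra hxs
  simp at hx hxs
  exact hxs hx.1

end

end LogKirchhoff

/-! On the lattice the Dirichlet energy is controlled by the ℓ² norm, so `HSpace h lam` is the
weighted ℓ² space with weight ρ = λh + 1 (`mem_HSpace_iff`), and a weak solution is a function whose
pointwise residual vanishes at every vertex (`hasSum_pairing`, `isCriticalPoint_iff`). The solution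
is obtained by minimizing the energy over the sign-changing Nehari set.

Fibering. On the cone s u⁺ + t u⁻ the energy is an explicit function of (s, t) with nine
coefficients (`FiberData`). The logarithmic homogeneity of the nonlinearity, Bernoulli's inequality
and x log x ≥ x - 1 give `FiberData.val_le`: if both partial pairings of u vanish, then (1, 1) is
the strict global maximum on the closed quadrant. Since p > 4, the nonlinear term beats the quartic
Kirchhoff term at infinity, and the mass beats it near 0, so every cone has a positive critical
point. If both partial pairings at u are nonpositive, that point lies in (0, 1]².

Compactness. A nodal function supported on two vertices of the well has energy E independent of λ,
so minimizing sequences have mass at most (E + 1)/(1/2 - 1/p). For large λ, ρ exceeds this bound off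
the finite set D = {h < M}, which forces |u_n| ≤ 1 there. Now log u² ≤ 0 when |u| ≤ 1, so off D
every term in the energy and in the pairings with u_n⁺ and u_n⁻ has a favourable sign. Pointwise
convergence and Fatou's lemma (`eventually_sub_lt_tsum`) then suffice. The Nehari conditions force
values ≥ 1 and ≤ -1 on D, so both parts survive in the limit. The limit has nonpositive partial
pairings, hence can be scaled back into the Nehari set by (s, t) in (0, 1]²; comparing with s u_n⁺ +
t u_n⁻, whose energy is at most that of u_n, shows that it is a minimizer (`exists_minimizer`).

Criticality. If the derivative at a minimizer were negative in a one-vertex direction that keeps the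
two sign parts separate, a small perturbation would lower the energy on a whole box of the cone
around (1, 1). The perturbed maximum would remain interior, giving a nodal point of smaller energy
(`pairing_single_nonneg`). Using both w and -w, the residual vanishes everywhere.

Strict inequality. Each part of the minimizer is scaled onto the Nehari manifold separately. The
Kirchhoff term contributes the positive cross term (b/2)∫|∇f|²∫|∇g|², so m is strictly above the sum
of two Nehari energies (`exists_energy_add_lt`). -/

namespace LogKirchhoff

/-! ### Scalar calculus of the logarithmic nonlinearity. -/

noncomputable section

/-- The nonlinearity `f(t) = |t|^(p-2) t log t²`. -/
def nonlin (p t : ℝ) : ℝ := |t| ^ (p - 2) * t * Real.log (t ^ 2)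

/-- The primitive of `nonlin p`. -/
def prim (p t : ℝ) : ℝ := |t| ^ p * Real.log (t ^ 2) / p - 2 / p ^ 2 * |t| ^ p

theorem continuous_abs_rpow {q : ℝ} (hq : 0 ≤ q) : Continuous fun t : ℝ => |t| ^ q :=
  continuous_abs.rpow_const fun _ => Or.inr hq

/-- Up to the factor 2/q this is x log x at x = |t|^q, which extends continuously to 0. -/
theorem continuous_abs_rpow_mul_log {q : ℝ} (hq : 0 < q) :
    Continuous fun t : ℝ => |t| ^ q * Real.log (t ^ 2) := by
  have e : (fun t : ℝ => |t| ^ q * Real.log (t ^ 2)) =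
      fun t => 2 / q * (|t| ^ q * Real.log (|t| ^ q)) := by
    funext t
    rcases eq_or_ne t 0 with rfl | ht
    · simp [hq.ne']
    · rw [Real.log_rpow (abs_pos.2 ht), Real.log_abs, Real.log_pow]
      push_cast
      field_simp
  rw [e]
  exact continuous_const.mul (Real.continuous_mul_log.comp (continuous_abs_rpow hq.le))

theorem abs_rpow_eq_sub_two {p : ℝ} (hp : 2 < p) (t : ℝ) : |t| ^ p = |t| ^ (p - 2) * t ^ 2 := by
  rw [← sq_abs t, ← Real.rpow_natCast, ← Real.rpow_add' (abs_nonneg _) (by push_cast; linarith)]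
  congr 1
  push_cast
  ring

/-- The difference quotient at 0 is k itself. This treats the point t = 0, where neither |t|^q nor
log t² can be differentiated by the chain rule. -/
theorem hasDerivAt_id_mul_zero {k : ℝ → ℝ} (hk : ContinuousAt k 0) :
    HasDerivAt (fun t => t * k t) (k 0) 0 := by
  rw [hasDerivAt_iff_tendsto_slope]
  refine (hk.tendsto.mono_left nhdsWithin_le_nhds).congr' ?_
  filter_upwards [self_mem_nhdsWithin] with t ht
  have ht' : t ≠ 0 := ht
  simp [slope, ht']

theorem hasDerivAt_abs_rpow {q t : ℝ} (ht : t ≠ 0) :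
    HasDerivAt (fun t : ℝ => |t| ^ q) (q * |t| ^ (q - 2) * t) t := by
  have e : ∀ r t : ℝ, |t| ^ r = (t ^ 2) ^ (r / 2) := by
    intro r t
    rw [← sq_abs t, ← Real.rpow_natCast, ← Real.rpow_mul (abs_nonneg _)]
    congr 1
    push_cast
    ring
  have h1 : HasDerivAt (fun t : ℝ => t ^ 2) (2 * t) t := by simpa using hasDerivAt_pow 2 t
  have h2 := h1.rpow_const (p := q / 2) (Or.inl (by positivity))
  have e1 : (fun t : ℝ => |t| ^ q) = fun t => (t ^ 2) ^ (q / 2) := funext (e q)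
  rw [e1]
  convert h2 using 1
  rw [e, show (q - 2) / 2 = q / 2 - 1 by ring]
  ring

theorem hasDerivAt_log_sq {t : ℝ} (ht : t ≠ 0) :
    HasDerivAt (fun t : ℝ => Real.log (t ^ 2)) (2 / t) t := by
  have h1 : HasDerivAt (fun t : ℝ => t ^ 2) (2 * t) t := by simpa using hasDerivAt_pow 2 t
  convert h1.log (by positivity) using 1
  field_simp

theorem hasDerivAt_prim {p : ℝ} (hp : 3 < p) (t : ℝ) : HasDerivAt (prim p) (nonlin p t) t := by
  rcases eq_or_ne t 0 with rfl | ht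
  · have hk : Continuous fun t : ℝ =>
        t * (|t| ^ (p - 2) * Real.log (t ^ 2)) / p - 2 / p ^ 2 * (t * |t| ^ (p - 2)) :=
      ((continuous_id.mul (continuous_abs_rpow_mul_log (by linarith))).div_const _).sub
        (continuous_const.mul (continuous_id.mul (continuous_abs_rpow (by linarith))))
    convert hasDerivAt_id_mul_zero hk.continuousAt using 1
    · funext t
      rw [prim, abs_rpow_eq_sub_two (by linarith)]
      ring
    · simp [nonlin]
  · have h1 := (((hasDerivAt_abs_rpow (q := p) ht).mul (hasDerivAt_log_sq ht)).div_const p).sub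
      ((hasDerivAt_abs_rpow (q := p) ht).const_mul (2 / p ^ 2))
    refine h1.congr_deriv ?_
    rw [nonlin, abs_rpow_eq_sub_two (p := p) (by linarith)]
    have : p ≠ 0 := by linarith
    field_simp
    ring

/-- The derivative of `nonlin p`. -/
def nonlinDeriv (p t : ℝ) : ℝ :=
  (p - 1) * (|t| ^ (p - 2) * Real.log (t ^ 2)) + 2 * |t| ^ (p - 2)

theorem continuous_nonlinDeriv {p : ℝ} (hp : 3 < p) : Continuous (nonlinDeriv p) :=
  (continuous_const.mul (continuous_abs_rpow_mul_log (by linarith))).add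
    (continuous_const.mul (continuous_abs_rpow (by linarith)))

theorem hasDerivAt_nonlin {p : ℝ} (hp : 4 < p) (t : ℝ) :
    HasDerivAt (nonlin p) (nonlinDeriv p t) t := by
  rcases eq_or_ne t 0 with rfl | ht
  · convert hasDerivAt_id_mul_zero
      (continuous_abs_rpow_mul_log (q := p - 2) (by linarith)).continuousAt using 1
    · funext t
      rw [nonlin]
      ring
    · simp [nonlinDeriv, show p - 2 ≠ 0 by linarith]
  · have h1 := ((hasDerivAt_abs_rpow (q := p - 2) ht).mul (hasDerivAt_id t)).mul
      (hasDerivAt_log_sq ht)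
    refine h1.congr_deriv ?_
    have e := abs_rpow_eq_sub_two (p := p - 2) (by linarith) t
    simp only [id, Pi.mul_apply, nonlinDeriv]
    rw [e]
    field_simp
    ring

theorem continuous_nonlin {p : ℝ} (hp : 4 < p) : Continuous (nonlin p) :=
  continuous_iff_continuousAt.2 fun t => (hasDerivAt_nonlin hp t).continuousAt

theorem continuous_prim {p : ℝ} (hp : 3 < p) : Continuous (prim p) :=
  continuous_iff_continuousAt.2 fun t => (hasDerivAt_prim hp t).continuousAt

theorem exists_bound_of_continuous {k : ℝ → ℝ} (hk : Continuous k) (R : ℝ) :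
    ∃ C, 0 ≤ C ∧ ∀ t, |t| ≤ R → |k t| ≤ C := by
  obtain ⟨C, hC⟩ := (isCompact_Icc (a := -R) (b := R)).exists_bound_of_continuousOn hk.continuousOn
  exact ⟨max C 0, le_max_right _ _, fun t ht => (hC t (abs_le.1 ht)).trans (le_max_left _ _)⟩

/-- Members of the weighted space are bounded functions, so such local comparisons with t² reduce
the summability of the nonlinear terms to square-summability. -/
theorem exists_abs_rpow_le {p : ℝ} (hp : 2 < p) (R : ℝ) :
    ∃ C, 0 ≤ C ∧ ∀ t, |t| ≤ R → |t| ^ p ≤ C * t ^ 2 := by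
  obtain ⟨C, hC, h⟩ := exists_bound_of_continuous
    (continuous_abs_rpow (q := p - 2) (by linarith)) R
  refine ⟨C, hC, fun t ht => ?_⟩
  rw [abs_rpow_eq_sub_two hp]
  exact mul_le_mul_of_nonneg_right ((le_abs_self _).trans (h t ht)) (sq_nonneg _)

theorem exists_abs_rpow_mul_log_le {p : ℝ} (hp : 2 < p) (R : ℝ) :
    ∃ C, 0 ≤ C ∧ ∀ t, |t| ≤ R → |(|t| ^ p * Real.log (t ^ 2))| ≤ C * t ^ 2 := by
  obtain ⟨C, hC, h⟩ := exists_bound_of_continuous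
    (continuous_abs_rpow_mul_log (q := p - 2) (by linarith)) R
  refine ⟨C, hC, fun t ht => ?_⟩
  rw [abs_rpow_eq_sub_two hp, mul_right_comm, abs_mul, abs_of_nonneg (sq_nonneg t)]
  exact mul_le_mul_of_nonneg_right (h t ht) (sq_nonneg _)

theorem exists_abs_nonlin_le {p : ℝ} (hp : 2 < p) (R : ℝ) :
    ∃ C, 0 ≤ C ∧ ∀ t, |t| ≤ R → |nonlin p t| ≤ C * |t| := by
  obtain ⟨C, hC, h⟩ := exists_bound_of_continuous
    (continuous_abs_rpow_mul_log (q := p - 2) (by linarith)) R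
  refine ⟨C, hC, fun t ht => ?_⟩
  rw [nonlin, mul_right_comm, abs_mul]
  exact mul_le_mul_of_nonneg_right (h t ht) (abs_nonneg _)

/-- Second order Taylor estimate for the primitive. -/
theorem exists_prim_taylor {p : ℝ} (hp : 4 < p) (R : ℝ) :
    ∃ C, 0 ≤ C ∧ ∀ t s, |t| ≤ R → |t + s| ≤ R →
      |prim p (t + s) - prim p t - nonlin p t * s| ≤ C * s ^ 2 := by
  obtain ⟨C, hC, h⟩ := exists_bound_of_continuous (continuous_nonlinDeriv (p := p) (by linarith)) R
  refine ⟨C, hC, fun t s ht hs => ?_⟩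
  have hlip : ∀ x ∈ Set.Icc (-R) R, ∀ y ∈ Set.Icc (-R) R,
      |nonlin p y - nonlin p x| ≤ C * |y - x| := fun x hx y hy =>
    (convex_Icc (-R) R).norm_image_sub_le_of_norm_hasDerivWithin_le
      (fun z _ => (hasDerivAt_nonlin hp z).hasDerivWithinAt) (fun z hz => h z (abs_le.2 hz)) hx hy
  have hsub : Set.uIcc t (t + s) ⊆ Set.Icc (-R) R :=
    Set.uIcc_subset_Icc (abs_le.1 ht) (abs_le.1 hs)
  -- Mean value inequality for the primitive minus its tangent at t: by the Lipschitz bound, the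
  -- derivative is at most C|s| between t and t + s.
  have key := (convex_uIcc t (t + s)).norm_image_sub_le_of_norm_hasDerivWithin_le
    (f := fun z => prim p z - nonlin p t * z) (f' := fun z => nonlin p z - nonlin p t)
    (C := C * |s|)
    (fun z _ => ((hasDerivAt_prim (by linarith) z).sub
      (by simpa using (hasDerivAt_id z).const_mul (nonlin p t))).hasDerivWithinAt)
    (fun z hz => by
      refine (hlip t (abs_le.1 ht) z (hsub hz)).trans (mul_le_mul_of_nonneg_left ?_ hC)
      have := Set.abs_sub_left_of_mem_uIcc hz
      simpa using this)
    Set.left_mem_uIcc Set.right_mem_uIcc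
  have e : prim p (t + s) - prim p t - nonlin p t * s =
      prim p (t + s) - nonlin p t * (t + s) - (prim p t - nonlin p t * t) := by ring
  rw [e]
  refine key.trans (le_of_eq ?_)
  rw [add_sub_cancel_left, Real.norm_eq_abs, mul_assoc, ← sq, sq_abs]

theorem nonlin_mul_self {p : ℝ} (hp : 2 < p) (t : ℝ) :
    nonlin p t * t = |t| ^ p * Real.log (t ^ 2) := by
  rw [nonlin, abs_rpow_eq_sub_two hp]
  ring

theorem log_sq_nonpos {t : ℝ} (ht : |t| ≤ 1) : Real.log (t ^ 2) ≤ 0 :=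
  Real.log_nonpos (sq_nonneg _) ((sq_le_one_iff_abs_le_one t).2 ht)

theorem nonlin_mul_self_nonpos {p : ℝ} (hp : 2 < p) {t : ℝ} (ht : |t| ≤ 1) :
    nonlin p t * t ≤ 0 := by
  rw [nonlin_mul_self hp]
  exact mul_nonpos_of_nonneg_of_nonpos (by positivity) (log_sq_nonpos ht)

/-- The logarithm is nonpositive for |t| ≤ 1. This sign, and the one in `nonlin_mul_self_nonpos`,
makes Fatou's lemma applicable off a finite set. -/
theorem prim_nonpos {p : ℝ} (hp : 2 < p) {t : ℝ} (ht : |t| ≤ 1) : prim p t ≤ 0 := by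
  have h1 : |t| ^ p * Real.log (t ^ 2) ≤ 0 :=
    mul_nonpos_of_nonneg_of_nonpos (by positivity) (log_sq_nonpos ht)
  have h2 : 0 ≤ 2 / p ^ 2 * |t| ^ p := by positivity
  have h3 := div_nonpos_of_nonpos_of_nonneg h1 (show 0 ≤ p by linarith)
  unfold prim
  linarith

theorem prim_zero {p : ℝ} (hp : 2 < p) : prim p 0 = 0 := by
  simp [prim, show p ≠ 0 by linarith]

theorem nonlin_neg (p t : ℝ) : nonlin p (-t) = -nonlin p t := by simp [nonlin]

theorem prim_neg (p t : ℝ) : prim p (-t) = prim p t := by simp [prim]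

theorem abs_mul_rpow {p s : ℝ} (hs : 0 ≤ s) (t : ℝ) : |s * t| ^ p = s ^ p * |t| ^ p := by
  rw [abs_mul, abs_of_nonneg hs, Real.mul_rpow hs (abs_nonneg _)]

/-- Logarithmic homogeneity of `f(t) t`. -/
theorem nonlin_mul_self_mul {p s : ℝ} (hp : 2 < p) (hs : 0 ≤ s) (t : ℝ) :
    nonlin p (s * t) * (s * t) =
      s ^ p * (nonlin p t * t + Real.log (s ^ 2) * |t| ^ p) := by
  rw [nonlin_mul_self hp, nonlin_mul_self hp, abs_mul_rpow hs]
  rcases hs.eq_or_lt with rfl | hs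
  · simp [show p ≠ 0 by linarith]
  rcases eq_or_ne t 0 with rfl | ht
  · simp [show p ≠ 0 by linarith]
  rw [mul_pow, Real.log_mul (by positivity) (by positivity)]
  ring

theorem prim_eq {p : ℝ} (hp : 2 < p) (t : ℝ) :
    prim p t = nonlin p t * t / p - 2 / p ^ 2 * |t| ^ p := by
  rw [nonlin_mul_self hp, prim]

theorem prim_mul {p s : ℝ} (hp : 2 < p) (hs : 0 ≤ s) (t : ℝ) :
    prim p (s * t) = s ^ p * (nonlin p t * t / p +
      (Real.log (s ^ 2) / p - 2 / p ^ 2) * |t| ^ p) := by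
  rw [prim_eq hp, nonlin_mul_self_mul hp hs, abs_mul_rpow hs]
  ring

/-- `2(1 - sᵖ) + p sᵖ log s² ≥ 0`. -/
theorem log_scale_nonneg {p s : ℝ} (hs : 0 ≤ s) (hp : 0 < p) :
    0 ≤ 2 * (1 - s ^ p) + p * (s ^ p * Real.log (s ^ 2)) := by
  rcases hs.eq_or_lt with rfl | hs
  · simp [hp.ne']
  -- This is y - 1 ≤ y log y at y = s^p.
  have h1 := Real.self_sub_one_le_mul_log (Real.rpow_nonneg hs.le p)
  rw [Real.log_rpow hs] at h1
  rw [Real.log_pow]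
  push_cast
  nlinarith

/-- `(1 - s^q)/q ≥ (1 - s^p)/p` for `0 < q ≤ p`. -/
theorem one_sub_rpow_div_le {p q s : ℝ} (hs : 0 ≤ s) (hq : 0 < q) (hqp : q ≤ p) :
    (1 - s ^ p) / p ≤ (1 - s ^ q) / q := by
  -- Bernoulli's inequality with base s^q and exponent p/q.
  have h := one_add_mul_self_le_rpow_one_add (s := s ^ q - 1) (p := p / q)
    (by linarith [Real.rpow_nonneg hs q]) ((one_le_div hq).2 hqp)
  rw [add_sub_cancel, ← Real.rpow_mul hs, mul_div_cancel₀ _ hq.ne'] at h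
  have hp : 0 < p := hq.trans_le hqp
  rw [div_le_div_iff₀ hp hq]
  have e : p / q * (s ^ q - 1) * q = p * (s ^ q - 1) := by field_simp
  nlinarith

/-- Strict Bernoulli with q = 2. The strictness makes the maximum on each cone unique. -/
theorem one_sub_rpow_div_lt {p s : ℝ} (hs : 0 ≤ s) (hs1 : s ≠ 1) (hp : 2 < p) :
    (1 - s ^ p) / p < (1 - s ^ 2) / 2 := by
  have hne : s ^ (2 : ℝ) - 1 ≠ 0 := by
    rw [Real.rpow_two]
    intro h0
    have : (s - 1) * (s + 1) = 0 := by linarith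
    rcases mul_eq_zero.1 this with h | h
    · exact hs1 (by linarith)
    · linarith
  have h := one_add_mul_self_lt_rpow_one_add (s := s ^ (2 : ℝ) - 1) (p := p / 2)
    (by linarith [Real.rpow_nonneg hs 2]) hne (by linarith)
  rw [add_sub_cancel, ← Real.rpow_mul hs, mul_div_cancel₀ _ two_ne_zero, Real.rpow_two] at h
  rw [div_lt_div_iff₀ (by linarith) two_pos]
  linarith

end

/-! ### Green's formula, the weighted ℓ² space and its quadratic forms. -/

noncomputable section

theorem sum_nbrs (g : V → ℝ) (x : V) :
    ∑ y ∈ nbrs x, g y = ∑ i : Fin 3, (g (x + Pi.single i 1) + g (x - Pi.single i 1)) := by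
  have hs : ∀ i j : Fin 3, (Pi.single i 1 : V) = Pi.single j 1 → i = j := by
    intro i j hij
    by_contra hne
    have := congrFun hij i
    simp [Pi.single_eq_of_ne hne] at this
  have hd : ∀ i j : Fin 3, (Pi.single i 1 : V) ≠ -Pi.single j 1 := by
    intro i j hij
    have := congrFun hij i
    rcases eq_or_ne i j with rfl | hne
    · simp at this
    · simp [Pi.single_eq_of_ne hne] at this
  rw [nbrs, Finset.sum_union, Finset.sum_image, Finset.sum_image, Finset.sum_add_distrib]
  · intro i _ j _ hij
    exact hs i j (by simpa using hij)
  · intro i _ j _ hij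
    exact hs i j (by simpa using hij)
  · rw [Finset.disjoint_left]
    intro y hy hy'
    obtain ⟨i, -, rfl⟩ := Finset.mem_image.1 hy
    obtain ⟨j, -, hj⟩ := Finset.mem_image.1 hy'
    refine hd i j ?_
    rw [sub_eq_add_neg] at hj
    exact (add_left_cancel hj).symm

theorem hasSum_of_eq {f g : V → ℝ} {S T : ℝ} (h : HasSum f S) (hfg : ∀ x, g x = f x)
    (hST : T = S) : HasSum g T := by
  rw [hST, funext hfg]
  exact h

theorem summable_mul_of_sq {u v : V → ℝ} (hu : Summable fun x => u x ^ 2)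
    (hv : Summable fun x => v x ^ 2) : Summable fun x => u x * v x := by
  refine Summable.of_norm_bounded (hu.add hv) fun x => ?_
  rw [Real.norm_eq_abs, abs_le]
  constructor <;> nlinarith [sq_nonneg (u x + v x), sq_nonneg (u x - v x)]

theorem summable_shift {g : V → ℝ} (hg : Summable g) (e : V) : Summable fun x => g (x + e) :=
  (Equiv.summable_iff (Equiv.addRight e)).2 hg

/-- The negative graph Laplacian. -/
def negLap (u : V → ℝ) (x : V) : ℝ := ∑ y ∈ nbrs x, (u x - u y)

/-- Green's formula. -/
theorem hasSum_gradForm {u v : V → ℝ} (hu : Summable fun x => u x ^ 2)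
    (hv : Summable fun x => v x ^ 2) :
    HasSum (gradForm u v) (∑' x, negLap u x * v x) ∧ Summable fun x => negLap u x * v x := by
  have hA := (summable_mul_of_sq hu hv).hasSum
  have shift : ∀ {g : V → ℝ} {S : ℝ} (e : V), HasSum g S → HasSum (fun x => g (x + e)) S :=
    fun e hg => (Equiv.hasSum_iff (Equiv.addRight e)).2 hg
  -- S e is the correlation of u, shifted by e, with v. By translation invariance, both sides of
  -- Green's formula contribute 2∑uv - S e - S (-e) in each coordinate direction e.
  have hB : ∀ e : V, ∃ S, HasSum (fun x => u (x + e) * v x) S := fun e =>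
    ⟨_, (summable_mul_of_sq (summable_shift hu e) hv).hasSum⟩
  choose S hS using hB
  have h1 : ∀ e : V, HasSum (fun x => (1 / 2) * ((u (x + e) - u x) * (v (x + e) - v x) +
      (u (x - e) - u x) * (v (x - e) - v x))) (2 * ∑' x, u x * v x - S e - S (-e)) := by
    intro e
    have a1 := shift e hA
    have a2 := shift (-e) hA
    have a3 := shift (-e) (hS e)
    have a4 := shift e (hS (-e))
    have := ((((a1.add a2).add (hA.mul_left 2)).sub ((hS e).add (hS (-e)))).sub
      (a3.add a4)).mul_left (1 / 2)
    refine hasSum_of_eq this (fun x => ?_) (by ring)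
    simp only [neg_add_cancel_right, add_neg_cancel_right]
    simp only [← sub_eq_add_neg]
    ring
  have h2 : ∀ e : V, HasSum (fun x => (2 * u x - u (x + e) - u (x - e)) * v x)
      (2 * ∑' x, u x * v x - S e - S (-e)) := by
    intro e
    refine hasSum_of_eq (((hA.mul_left 2).sub (hS e)).sub (hS (-e))) (fun x => ?_) rfl
    rw [← sub_eq_add_neg]
    ring
  have h3 := hasSum_sum (s := Finset.univ) fun (i : Fin 3) _ => h1 (Pi.single i 1)
  have h4 := hasSum_sum (s := Finset.univ) fun (i : Fin 3) _ => h2 (Pi.single i 1)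
  have e4 : (fun x => negLap u x * v x) =
      fun x => ∑ i : Fin 3, (2 * u x - u (x + Pi.single i 1) - u (x - Pi.single i 1)) * v x := by
    funext x
    rw [negLap, sum_nbrs (fun y => u x - u y), Finset.sum_mul]
    exact Finset.sum_congr rfl fun i _ => by ring
  have e3 : gradForm u v = fun x => ∑ i : Fin 3, (1 / 2) *
      ((u (x + Pi.single i 1) - u x) * (v (x + Pi.single i 1) - v x) +
      (u (x - Pi.single i 1) - u x) * (v (x - Pi.single i 1) - v x)) := by
    funext x
    rw [gradForm, sum_nbrs (fun y => (u y - u x) * (v y - v x)), Finset.mul_sum]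
  rw [e4, e3]
  exact ⟨h4.tsum_eq.symm ▸ h3, h4.summable⟩

theorem gradForm_comm (u v : V → ℝ) (x : V) : gradForm u v x = gradForm v u x := by
  unfold gradForm
  simp only [mul_comm]

theorem gradForm_add_left (u v w : V → ℝ) (x : V) :
    gradForm (u + v) w x = gradForm u w x + gradForm v w x := by
  unfold gradForm
  rw [← mul_add, ← Finset.sum_add_distrib]
  simp only [Pi.add_apply]
  congr 1
  exact Finset.sum_congr rfl fun y _ => by ring

theorem gradForm_smul_left (c : ℝ) (u w : V → ℝ) (x : V) :
    gradForm (c • u) w x = c * gradForm u w x := by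
  unfold gradForm
  rw [mul_left_comm]
  refine congrArg _ ?_
  rw [Finset.mul_sum]
  simp only [Pi.smul_apply, smul_eq_mul]
  exact Finset.sum_congr rfl fun y _ => by ring

theorem gradInt_comm (u v : V → ℝ) : gradInt u v = gradInt v u :=
  tsum_congr fun x => gradForm_comm u v x

theorem gradInt_smul_left (c : ℝ) (u w : V → ℝ) : gradInt (c • u) w = c * gradInt u w := by
  unfold gradInt
  rw [← tsum_mul_left]
  exact tsum_congr fun x => gradForm_smul_left c u w x

theorem gradInt_smul_right (c : ℝ) (u w : V → ℝ) : gradInt u (c • w) = c * gradInt u w := by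
  rw [gradInt_comm, gradInt_smul_left, gradInt_comm]

theorem gradInt_self_nonneg (u : V → ℝ) : 0 ≤ gradInt u u :=
  tsum_nonneg fun x => gradForm_self_nonneg u x

/-- The weighted space of functions with `∑ ρ u² < ∞`. -/
def weightedL2 (ρ : V → ℝ) (_hρ : ∀ x, 1 ≤ ρ x) : Submodule ℝ (V → ℝ) where
  carrier := {u | Summable fun x => ρ x * u x ^ 2}
  zero_mem' := by simp
  add_mem' := by
    intro u v hu hv
    refine Summable.of_nonneg_of_le (fun x => ?_) (fun x => ?_) ((hu.add hv).mul_left 2)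
    · exact mul_nonneg (zero_le_one.trans (_hρ x)) (sq_nonneg _)
    · have := mul_nonneg (zero_le_one.trans (_hρ x)) (sq_nonneg (u x - v x))
      simp only [Pi.add_apply]
      nlinarith
  smul_mem' := by
    intro c u hu
    refine (hu.mul_left (c ^ 2)).congr fun x => ?_
    simp only [Pi.smul_apply, smul_eq_mul]
    ring

/-- The bilinear form `∑ ρ u v`. -/
def mass (ρ u v : V → ℝ) : ℝ := ∑' x, ρ x * u x * v x

section

variable {ρ : V → ℝ} {hρ : ∀ x, 1 ≤ ρ x} {u v w : V → ℝ}

theorem mem_weightedL2 : u ∈ weightedL2 ρ hρ ↔ Summable fun x => ρ x * u x ^ 2 := Iff.rfl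

theorem mem_of_abs_le (hu : u ∈ weightedL2 ρ hρ) (h : ∀ x, |v x| ≤ |u x|) :
    v ∈ weightedL2 ρ hρ := by
  refine Summable.of_nonneg_of_le (fun x => ?_) (fun x => ?_) hu
  · exact mul_nonneg (zero_le_one.trans (hρ x)) (sq_nonneg _)
  · exact mul_le_mul_of_nonneg_left (sq_le_sq.2 (h x)) (zero_le_one.trans (hρ x))

theorem summable_sq (hu : u ∈ weightedL2 ρ hρ) : Summable fun x => u x ^ 2 :=
  Summable.of_nonneg_of_le (fun _ => sq_nonneg _)
    (fun x => le_mul_of_one_le_left (sq_nonneg _) (hρ x)) hu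

theorem summable_weight_mul (hu : u ∈ weightedL2 ρ hρ) (hv : v ∈ weightedL2 ρ hρ) :
    Summable fun x => ρ x * u x * v x := by
  refine Summable.of_norm_bounded (Summable.add hu hv) fun x => ?_
  have h0 := zero_le_one.trans (hρ x)
  rw [Real.norm_eq_abs, abs_le]
  constructor <;> nlinarith [mul_nonneg h0 (sq_nonneg (u x + v x)),
    mul_nonneg h0 (sq_nonneg (u x - v x)), mul_nonneg h0 (sq_nonneg (u x)),
    mul_nonneg h0 (sq_nonneg (v x))]

theorem summable_gradForm (hu : u ∈ weightedL2 ρ hρ) (hv : v ∈ weightedL2 ρ hρ) :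
    Summable (gradForm u v) := (hasSum_gradForm (summable_sq hu) (summable_sq hv)).1.summable

theorem gradInt_eq_tsum_negLap (hu : u ∈ weightedL2 ρ hρ) (hv : v ∈ weightedL2 ρ hρ) :
    gradInt u v = ∑' x, negLap u x * v x :=
  (hasSum_gradForm (summable_sq hu) (summable_sq hv)).1.tsum_eq

theorem gradInt_add_left (hu : u ∈ weightedL2 ρ hρ) (hv : v ∈ weightedL2 ρ hρ)
    (hw : w ∈ weightedL2 ρ hρ) : gradInt (u + v) w = gradInt u w + gradInt v w := by
  unfold gradInt
  rw [← (summable_gradForm hu hw).tsum_add (summable_gradForm hv hw)]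
  exact tsum_congr fun x => gradForm_add_left u v w x

theorem gradInt_add_right (hu : u ∈ weightedL2 ρ hρ) (hv : v ∈ weightedL2 ρ hρ)
    (hw : w ∈ weightedL2 ρ hρ) : gradInt w (u + v) = gradInt w u + gradInt w v := by
  rw [gradInt_comm, gradInt_add_left hu hv hw, gradInt_comm u, gradInt_comm v]

theorem mass_comm (ρ u v : V → ℝ) : mass ρ u v = mass ρ v u :=
  tsum_congr fun _ => by ring

theorem mass_smul_left (c : ℝ) (ρ u v : V → ℝ) : mass ρ (c • u) v = c * mass ρ u v := by
  unfold mass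
  rw [← tsum_mul_left]
  exact tsum_congr fun x => by simp only [Pi.smul_apply, smul_eq_mul]; ring

theorem mass_smul_right (c : ℝ) (ρ u v : V → ℝ) : mass ρ u (c • v) = c * mass ρ u v := by
  rw [mass_comm, mass_smul_left, mass_comm]

theorem mass_add_left (hu : u ∈ weightedL2 ρ hρ) (hv : v ∈ weightedL2 ρ hρ)
    (hw : w ∈ weightedL2 ρ hρ) : mass ρ (u + v) w = mass ρ u w + mass ρ v w := by
  unfold mass
  rw [← (summable_weight_mul hu hw).tsum_add (summable_weight_mul hv hw)]
  exact tsum_congr fun x => by simp only [Pi.add_apply]; ring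

theorem mass_add_right (hu : u ∈ weightedL2 ρ hρ) (hv : v ∈ weightedL2 ρ hρ)
    (hw : w ∈ weightedL2 ρ hρ) : mass ρ w (u + v) = mass ρ w u + mass ρ w v := by
  rw [mass_comm, mass_add_left hu hv hw, mass_comm ρ u, mass_comm ρ v]

theorem mass_term_nonneg (hρ : ∀ x, 1 ≤ ρ x) (u : V → ℝ) (x : V) : 0 ≤ ρ x * u x * u x := by
  have := mul_nonneg (zero_le_one.trans (hρ x)) (mul_self_nonneg (u x))
  rwa [← mul_assoc] at this

theorem mass_self_nonneg (hρ : ∀ x, 1 ≤ ρ x) (u : V → ℝ) : 0 ≤ mass ρ u u :=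
  tsum_nonneg (mass_term_nonneg hρ u)

theorem weight_mul_sq_le_mass (hu : u ∈ weightedL2 ρ hρ) (x : V) :
    ρ x * u x ^ 2 ≤ mass ρ u u := by
  have := (summable_weight_mul hu hu).le_tsum x fun y _ => mass_term_nonneg hρ u y
  rw [sq, ← mul_assoc]
  exact this

theorem sq_le_mass (hu : u ∈ weightedL2 ρ hρ) (x : V) : u x ^ 2 ≤ mass ρ u u :=
  (le_mul_of_one_le_left (sq_nonneg _) (hρ x)).trans (weight_mul_sq_le_mass hu x)

theorem mass_self_pos (hu : u ∈ weightedL2 ρ hρ) (h0 : u ≠ 0) : 0 < mass ρ u u := by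
  obtain ⟨x, hx⟩ := Function.ne_iff.1 h0
  exact (pow_pos (abs_pos.2 hx) 2).trans_le ((sq_abs _).le.trans (sq_le_mass hu x))

theorem exists_abs_le (hu : u ∈ weightedL2 ρ hρ) : ∃ R, 0 ≤ R ∧ ∀ x, |u x| ≤ R :=
  ⟨√(mass ρ u u), Real.sqrt_nonneg _, fun x => Real.abs_le_sqrt (sq_le_mass hu x)⟩

/-- Zero Dirichlet energy makes u constant along every half-line in the first coordinate direction;
a square-summable constant on an infinite set is 0. -/
theorem gradInt_self_pos (hu : u ∈ weightedL2 ρ hρ) (h0 : u ≠ 0) : 0 < gradInt u u := by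
  refine (gradInt_self_nonneg u).lt_of_ne fun hE => h0 ?_
  have hz : ∀ x, gradForm u u x = 0 := by
    have := (hasSum_zero_iff_of_nonneg fun x => gradForm_self_nonneg u x).1
      (by rw [hE]; exact (summable_gradForm hu hu).hasSum)
    exact fun x => congrFun this x
  have hstep : ∀ x : V, u (x + Pi.single 0 1) = u x := by
    intro x
    have h1 := hz x
    have hnn : ∀ y ∈ nbrs x, 0 ≤ (u y - u x) * (u y - u x) := fun y _ => mul_self_nonneg _
    rw [gradForm, mul_eq_zero, or_iff_right (by norm_num), Finset.sum_eq_zero_iff_of_nonneg hnn]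
      at h1
    have := h1 (x + Pi.single 0 1) (by simp [nbrs])
    linarith [mul_self_eq_zero.1 this]
  have hline : ∀ (x : V) (n : ℕ), u (x + n • Pi.single 0 1) = u x := by
    intro x n
    induction n with
    | zero => simp
    | succ k ih => rw [succ_nsmul, ← add_assoc, hstep, ih]
  funext x
  have hinj : Function.Injective fun n : ℕ => x + n • (Pi.single 0 1 : V) := by
    intro m n hmn
    have := congrFun (add_left_cancel hmn) 0
    simpa using this
  have hs := (summable_sq hu).comp_injective hinj
  have hc : Summable fun _ : ℕ => u x ^ 2 := hs.congr fun n => by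
    simp only [Function.comp_apply, hline]
  have := (summable_const_iff _).1 hc
  simpa using this

/-- Cauchy-Schwarz for the gradient form. -/
theorem gradInt_sq_le (hu : u ∈ weightedL2 ρ hρ) (hv : v ∈ weightedL2 ρ hρ) :
    gradInt u v ^ 2 ≤ gradInt u u * gradInt v v := by
  have h : ∀ t : ℝ, 0 ≤ gradInt v v * (t * t) + 2 * gradInt u v * t + gradInt u u := by
    intro t
    have h1 := gradInt_self_nonneg (u + t • v)
    have htv := Submodule.smul_mem _ t hv
    rw [gradInt_add_left hu htv (Submodule.add_mem _ hu htv), gradInt_add_right hu htv hu,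
      gradInt_add_right hu htv htv] at h1
    simp only [gradInt_smul_left, gradInt_smul_right] at h1
    rw [gradInt_comm v u] at h1
    linarith
  have := discrim_le_zero h
  rw [discrim] at this
  linarith

theorem gradInt_comb (hu : u ∈ weightedL2 ρ hρ) (hv : v ∈ weightedL2 ρ hρ) (s t : ℝ) :
    gradInt (s • u + t • v) (s • u + t • v) =
      s ^ 2 * gradInt u u + 2 * (s * t) * gradInt u v + t ^ 2 * gradInt v v := by
  have hsu := Submodule.smul_mem _ s hu
  have htv := Submodule.smul_mem _ t hv
  rw [gradInt_add_left hsu htv (Submodule.add_mem _ hsu htv), gradInt_add_right hsu htv hsu,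
    gradInt_add_right hsu htv htv]
  simp only [gradInt_smul_left, gradInt_smul_right]
  rw [gradInt_comm v u]
  ring

theorem mass_comb (hu : u ∈ weightedL2 ρ hρ) (hv : v ∈ weightedL2 ρ hρ) (s t : ℝ) :
    mass ρ (s • u + t • v) (s • u + t • v) =
      s ^ 2 * mass ρ u u + 2 * (s * t) * mass ρ u v + t ^ 2 * mass ρ v v := by
  have hsu := Submodule.smul_mem _ s hu
  have htv := Submodule.smul_mem _ t hv
  rw [mass_add_left hsu htv (Submodule.add_mem _ hsu htv), mass_add_right hsu htv hsu,
    mass_add_right hsu htv htv]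
  simp only [mass_smul_left, mass_smul_right]
  rw [mass_comm ρ v u]
  ring

theorem single_mem (x : V) (c : ℝ) : (Pi.single x c : V → ℝ) ∈ weightedL2 ρ hρ := by
  refine mem_weightedL2.2 (summable_of_ne_finset_zero (s := {x}) fun y hy => ?_)
  rw [Finset.mem_singleton] at hy
  simp [Pi.single_eq_of_ne hy]

theorem mass_eq_zero_of_disjoint (h : ∀ x, u x * v x = 0) : mass ρ u v = 0 := by
  unfold mass
  simp [mul_assoc, h]

/-- The gradient form of functions of opposite signs and disjoint supports is nonnegative. -/
theorem gradForm_nonneg_of_disjoint (hu : ∀ x, 0 ≤ u x) (hv : ∀ x, v x ≤ 0)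
    (h : ∀ x, u x * v x = 0) (x : V) : 0 ≤ gradForm u v x := by
  unfold gradForm
  refine mul_nonneg (by norm_num) (Finset.sum_nonneg fun y _ => ?_)
  -- Disjointness kills the diagonal products, leaving -u(y)v(x) - u(x)v(y), which is nonnegative.
  nlinarith [h x, h y, mul_nonneg (hu x) (neg_nonneg.2 (hv y)),
    mul_nonneg (hu y) (neg_nonneg.2 (hv x))]

end

/-! ### Positive and negative parts. -/

theorem posPart_nonneg (u : V → ℝ) (x : V) : 0 ≤ posPart u x := le_max_right _ _

theorem negPart_nonpos (u : V → ℝ) (x : V) : negPart u x ≤ 0 := min_le_right _ _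

theorem posPart_add_negPart (u : V → ℝ) : posPart u + negPart u = u := by
  funext x
  simp [posPart, negPart, max_add_min]

theorem posPart_mul_negPart (u : V → ℝ) (x : V) : posPart u x * negPart u x = 0 := by
  rcases le_total (u x) 0 with h | h
  · simp [posPart, h]
  · simp [negPart, h]

theorem posPart_of_disjoint {f g : V → ℝ} (hf : ∀ x, 0 ≤ f x) (hg : ∀ x, g x ≤ 0)
    (h : ∀ x, f x * g x = 0) : posPart (f + g) = f ∧ negPart (f + g) = g := by
  constructor <;> funext x <;> rcases mul_eq_zero.1 (h x) with h0 | h0 <;>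
    simp [posPart, negPart, h0, hf x, hg x]

theorem posPart_neg (u : V → ℝ) : posPart (-u) = -negPart u := by
  funext x
  simp [posPart, negPart, ← max_neg_neg]

theorem negPart_neg (u : V → ℝ) : negPart (-u) = -posPart u := by
  funext x
  simp [posPart, negPart, ← min_neg_neg]

theorem posPart_mem {ρ : V → ℝ} {hρ : ∀ x, 1 ≤ ρ x} {u : V → ℝ} (hu : u ∈ weightedL2 ρ hρ) :
    posPart u ∈ weightedL2 ρ hρ :=
  mem_of_abs_le hu fun x => by
    rw [abs_of_nonneg (posPart_nonneg u x)]
    exact max_le (le_abs_self _) (abs_nonneg _)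

theorem negPart_mem {ρ : V → ℝ} {hρ : ∀ x, 1 ≤ ρ x} {u : V → ℝ} (hu : u ∈ weightedL2 ρ hρ) :
    negPart u ∈ weightedL2 ρ hρ :=
  mem_of_abs_le hu fun x => by
    rw [abs_of_nonpos (negPart_nonpos u x), ← abs_neg]
    exact neg_le.1 (le_min (neg_le.1 (le_abs_self _)) (by simp))

end

/-! ### The energy functional and its derivative. -/

noncomputable section

/-- The energy functional with weight `ρ = λ h + 1`. -/
def energy (a b p : ℝ) (ρ u : V → ℝ) : ℝ :=
  (1 / 2) * (a * gradInt u u + mass ρ u u) + (b / 4) * gradInt u u ^ 2 - ∑' x, prim p (u x)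

/-- The derivative of `energy`. -/
def pairing (a b p : ℝ) (ρ u φ : V → ℝ) : ℝ :=
  a * gradInt u φ + mass ρ u φ + b * gradInt u u * gradInt u φ - ∑' x, nonlin p (u x) * φ x

/-- The quantity `∑ |u|ᵖ log u²`. -/
def logMass (p : ℝ) (u : V → ℝ) : ℝ := ∑' x, nonlin p (u x) * u x

/-- The quantity `∑ |u|ᵖ`. -/
def lpMass (p : ℝ) (u : V → ℝ) : ℝ := ∑' x, |u x| ^ p

/-- The pointwise residual of the equation. -/
def residual (a b p : ℝ) (ρ u : V → ℝ) (x : V) : ℝ :=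
  (a + b * gradInt u u) * negLap u x + ρ x * u x - nonlin p (u x)

section

variable {a b p : ℝ} {ρ : V → ℝ} {hρ : ∀ x, 1 ≤ ρ x} {u v f g φ : V → ℝ}

theorem summable_abs_rpow (hp : 2 < p) (hu : u ∈ weightedL2 ρ hρ) :
    Summable fun x => |u x| ^ p := by
  obtain ⟨R, -, hR⟩ := exists_abs_le hu
  obtain ⟨C, -, hC⟩ := exists_abs_rpow_le hp R
  exact Summable.of_nonneg_of_le (fun x => by positivity) (fun x => hC _ (hR x))
    ((summable_sq hu).mul_left C)

theorem summable_abs_rpow_mul_log (hp : 2 < p) (hu : u ∈ weightedL2 ρ hρ) :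
    Summable fun x => |u x| ^ p * Real.log (u x ^ 2) := by
  obtain ⟨R, -, hR⟩ := exists_abs_le hu
  obtain ⟨C, -, hC⟩ := exists_abs_rpow_mul_log_le hp R
  exact Summable.of_norm_bounded ((summable_sq hu).mul_left C) fun x => hC _ (hR x)

theorem summable_nonlin_mul (hp : 2 < p) (hu : u ∈ weightedL2 ρ hρ) (hv : v ∈ weightedL2 ρ hρ) :
    Summable fun x => nonlin p (u x) * v x := by
  obtain ⟨R, -, hR⟩ := exists_abs_le hu
  obtain ⟨C, hC0, hC⟩ := exists_abs_nonlin_le hp R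
  refine Summable.of_norm_bounded (((summable_sq hu).add (summable_sq hv)).mul_left C) fun x => ?_
  rw [Real.norm_eq_abs, abs_mul]
  have h1 := mul_le_mul_of_nonneg_right (hC _ (hR x)) (abs_nonneg (v x))
  refine h1.trans ?_
  rw [mul_assoc]
  refine mul_le_mul_of_nonneg_left ?_ hC0
  rw [← sq_abs (u x), ← sq_abs (v x)]
  nlinarith [sq_nonneg (|u x| - |v x|), sq_nonneg (|u x|), sq_nonneg (|v x|)]

theorem summable_prim (hp : 2 < p) (hu : u ∈ weightedL2 ρ hρ) :
    Summable fun x => prim p (u x) := by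
  unfold prim
  exact ((summable_abs_rpow_mul_log hp hu).div_const p).sub
    ((summable_abs_rpow hp hu).mul_left _)

/-- By logarithmic homogeneity, the two numbers `logMass p u` and `lpMass p u` determine the
nonlinear energy along the whole ray through u. -/
theorem tsum_prim_smul (hp : 2 < p) (hu : u ∈ weightedL2 ρ hρ) {s : ℝ} (hs : 0 ≤ s) :
    ∑' x, prim p ((s • u) x) =
      s ^ p * (logMass p u / p + (Real.log (s ^ 2) / p - 2 / p ^ 2) * lpMass p u) := by
  have h := (((summable_nonlin_mul hp hu hu).hasSum.div_const p).add
    ((summable_abs_rpow hp hu).hasSum.mul_left (Real.log (s ^ 2) / p - 2 / p ^ 2))).mul_left (s ^ p)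
  rw [← lpMass, ← logMass] at h
  rw [← h.tsum_eq]
  exact tsum_congr fun x => prim_mul hp hs (u x)

theorem tsum_prim (hp : 2 < p) (hu : u ∈ weightedL2 ρ hρ) :
    ∑' x, prim p (u x) = logMass p u / p - 2 / p ^ 2 * lpMass p u := by
  have := tsum_prim_smul hp hu zero_le_one
  simp only [one_smul, Real.one_rpow, one_pow, Real.log_one] at this
  rw [this]
  ring

theorem logMass_smul (hp : 2 < p) (hu : u ∈ weightedL2 ρ hρ) {s : ℝ} (hs : 0 ≤ s) :
    logMass p (s • u) = s ^ p * (logMass p u + Real.log (s ^ 2) * lpMass p u) := by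
  have h := ((summable_nonlin_mul hp hu hu).hasSum.add
    ((summable_abs_rpow hp hu).hasSum.mul_left (Real.log (s ^ 2)))).mul_left (s ^ p)
  rw [← lpMass, ← logMass] at h
  rw [← h.tsum_eq]
  exact tsum_congr fun x => nonlin_mul_self_mul hp hs (u x)

theorem lpMass_pos (hp : 2 < p) (hu : u ∈ weightedL2 ρ hρ) (h0 : u ≠ 0) : 0 < lpMass p u := by
  obtain ⟨x, hx⟩ := Function.ne_iff.1 h0
  exact (summable_abs_rpow hp hu).tsum_pos (fun y => by positivity) x
    (Real.rpow_pos_of_pos (abs_pos.2 hx) p)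

theorem lpMass_nonneg (p : ℝ) (u : V → ℝ) : 0 ≤ lpMass p u :=
  tsum_nonneg fun x => by positivity

theorem tsum_prim_add_of_disjoint (hp : 2 < p) (hf : f ∈ weightedL2 ρ hρ)
    (hg : g ∈ weightedL2 ρ hρ) (h : ∀ x, f x * g x = 0) :
    ∑' x, prim p ((f + g) x) = ∑' x, prim p (f x) + ∑' x, prim p (g x) := by
  rw [← (summable_prim hp hf).tsum_add (summable_prim hp hg)]
  refine tsum_congr fun x => ?_
  rcases mul_eq_zero.1 (h x) with h0 | h0 <;> simp [h0, prim_zero hp]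

theorem tsum_nonlin_mul_of_disjoint (p : ℝ) (h : ∀ x, f x * g x = 0) :
    ∑' x, nonlin p ((f + g) x) * f x = logMass p f := by
  refine tsum_congr fun x => ?_
  rcases mul_eq_zero.1 (h x) with h0 | h0 <;> simp [h0]

/-- The derivative, tested against one of two summands with disjoint supports. -/
theorem pairing_of_disjoint (hf : f ∈ weightedL2 ρ hρ) (hg : g ∈ weightedL2 ρ hρ)
    (h : ∀ x, f x * g x = 0) :
    pairing a b p ρ (f + g) f = a * (gradInt f f + gradInt f g) + mass ρ f f +
      b * (gradInt f f + 2 * gradInt f g + gradInt g g) * (gradInt f f + gradInt f g) -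
      logMass p f := by
  rw [pairing, tsum_nonlin_mul_of_disjoint p h, gradInt_add_left hf hg hf,
    mass_add_left hf hg hf, mass_comm ρ g f, mass_eq_zero_of_disjoint h, gradInt_comm g f]
  have := gradInt_comb hf hg 1 1
  simp only [one_smul] at this
  rw [this]
  ring

theorem pairing_self : pairing a b p ρ u u =
    a * gradInt u u + mass ρ u u + b * gradInt u u ^ 2 - logMass p u := by
  rw [pairing, logMass]
  ring

theorem pairing_neg (u φ : V → ℝ) : pairing a b p ρ (-u) (-φ) = pairing a b p ρ u φ := by
  have e : ∀ u : V → ℝ, -u = (-1 : ℝ) • u := fun u => by simp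
  rw [pairing, pairing]
  have h1 : ∑' x, nonlin p ((-u) x) * (-φ) x = ∑' x, nonlin p (u x) * φ x :=
    tsum_congr fun x => by simp [nonlin_neg]
  rw [h1, e u, e φ]
  simp only [gradInt_smul_left, gradInt_smul_right, mass_smul_left, mass_smul_right]
  ring

theorem energy_neg (u : V → ℝ) : energy a b p ρ (-u) = energy a b p ρ u := by
  have h1 : ∑' x, prim p ((-u) x) = ∑' x, prim p (u x) := tsum_congr fun x => by simp [prim_neg]
  rw [energy, energy, h1, show -u = (-1 : ℝ) • u by simp]
  simp only [gradInt_smul_left, gradInt_smul_right, mass_smul_left, mass_smul_right]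
  ring

/-- Green's formula moves the difference operator onto u. Hence stationarity against all test
functions follows from vanishing of the residual at each vertex. -/
theorem hasSum_pairing (hp : 2 < p) (hu : u ∈ weightedL2 ρ hρ) (hφ : φ ∈ weightedL2 ρ hρ) :
    HasSum (fun x => residual a b p ρ u x * φ x) (pairing a b p ρ u φ) := by
  have h1 := (hasSum_gradForm (summable_sq hu) (summable_sq hφ)).2.hasSum
  rw [← gradInt_eq_tsum_negLap hu hφ] at h1
  have h2 := (summable_weight_mul hu hφ).hasSum
  have h3 := (summable_nonlin_mul hp hu hφ).hasSum
  refine hasSum_of_eq (((h1.mul_left (a + b * gradInt u u)).add h2).sub h3) (fun x => ?_) ?_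
  · rw [residual]
    ring
  · rw [pairing, mass]
    ring

theorem pairing_single (hp : 2 < p) (hu : u ∈ weightedL2 ρ hρ) (x : V) (c : ℝ) :
    pairing a b p ρ u (Pi.single x c) = residual a b p ρ u x * c := by
  rw [← (hasSum_pairing hp hu (single_mem x c)).tsum_eq, tsum_eq_single x fun y hy => by simp [hy]]
  simp

theorem pairing_smul (c : ℝ) : pairing a b p ρ u (c • φ) = c * pairing a b p ρ u φ := by
  have h1 : ∑' x, nonlin p (u x) * (c • φ) x = c * ∑' x, nonlin p (u x) * φ x := by
    rw [← tsum_mul_left]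
    exact tsum_congr fun x => by simp only [Pi.smul_apply, smul_eq_mul]; ring
  rw [pairing, pairing, h1, gradInt_smul_right, mass_smul_right]
  ring

theorem pairing_posPart_add_negPart (hp : 2 < p) (hu : u ∈ weightedL2 ρ hρ) :
    pairing a b p ρ u (posPart u) + pairing a b p ρ u (negPart u) = pairing a b p ρ u u := by
  have h := (hasSum_pairing (a := a) (b := b) hp hu (posPart_mem hu)).add
    (hasSum_pairing (a := a) (b := b) hp hu (negPart_mem hu))
  refine h.unique (hasSum_of_eq (hasSum_pairing hp hu hu) (fun x => ?_) rfl)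
  rw [← mul_add, ← Pi.add_apply, posPart_add_negPart]

/-- The factor 1/p cancels `logMass`, the one term of indefinite sign. -/
theorem energy_sub_pairing (hp : 2 < p) (hu : u ∈ weightedL2 ρ hρ) :
    energy a b p ρ u - 1 / p * pairing a b p ρ u u =
      (1 / 2 - 1 / p) * (a * gradInt u u + mass ρ u u) + b * (1 / 4 - 1 / p) * gradInt u u ^ 2 +
        2 / p ^ 2 * lpMass p u := by
  rw [energy, pairing_self, tsum_prim hp hu]
  ring

/-- For p > 4 the other terms of `energy_sub_pairing` are nonnegative. This gives the lower bound on
the Nehari sets and the boundedness of minimizing sequences. -/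
theorem mass_le_energy (ha : 0 ≤ a) (hb : 0 ≤ b) (hp : 4 < p) (hu : u ∈ weightedL2 ρ hρ)
    (h0 : pairing a b p ρ u u = 0) : (1 / 2 - 1 / p) * mass ρ u u ≤ energy a b p ρ u := by
  have h := energy_sub_pairing (a := a) (b := b) (show 2 < p by linarith) hu
  rw [h0, mul_zero, sub_zero] at h
  have h1 : 1 / p ≤ 1 / 4 := one_div_le_one_div_of_le (by norm_num) hp.le
  have h2 : 0 ≤ (1 / 2 - 1 / p) * (a * gradInt u u) :=
    mul_nonneg (by linarith) (mul_nonneg ha (gradInt_self_nonneg u))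
  have h3 : 0 ≤ b * (1 / 4 - 1 / p) * gradInt u u ^ 2 :=
    mul_nonneg (mul_nonneg hb (by linarith)) (sq_nonneg _)
  have h4 : 0 ≤ 2 / p ^ 2 * lpMass p u := mul_nonneg (by positivity) (lpMass_nonneg p u)
  rw [h]
  linarith

theorem half_sub_inv_pos (hp : 4 < p) : 0 < 1 / 2 - 1 / p := by
  have h1 : 1 / p ≤ 1 / 4 := one_div_le_one_div_of_le (by norm_num) hp.le
  linarith

/-- Second order Taylor estimate for the energy. -/
theorem exists_energy_taylor (ha : 0 ≤ a) (hb : 0 ≤ b) (hp : 4 < p) (hu : u ∈ weightedL2 ρ hρ)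
    {K : ℝ} (hK : 0 ≤ K) :
    ∃ C, 0 ≤ C ∧ ∀ φ ∈ weightedL2 ρ hρ, gradInt φ φ ≤ K → mass ρ φ φ ≤ 1 →
      |energy a b p ρ (u + φ) - energy a b p ρ u - pairing a b p ρ u φ| ≤
        C * (gradInt φ φ + mass ρ φ φ) := by
  obtain ⟨R, hR0, hR⟩ := exists_abs_le hu
  obtain ⟨C, hC0, hC⟩ := exists_prim_taylor hp (R + 1)
  have hZ := gradInt_self_nonneg u
  refine ⟨a / 2 + b / 4 * (8 * gradInt u u + 3 * K) + 1 / 2 + C, by positivity,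
    fun φ hφ hφK hφ1 => ?_⟩
  have hsum : |∑' x, (prim p ((u + φ) x) - prim p (u x) - nonlin p (u x) * φ x)| ≤
      C * mass ρ φ φ := by
    rw [mass, ← tsum_mul_left]
    have hle : ∀ x, ‖prim p ((u + φ) x) - prim p (u x) - nonlin p (u x) * φ x‖ ≤
        C * (ρ x * φ x * φ x) := by
      intro x
      have h1 : |φ x| ≤ 1 := by
        rw [← sq_le_one_iff_abs_le_one]
        exact (sq_le_mass hφ x).trans hφ1
      refine (hC (u x) (φ x) ((hR x).trans (by linarith))
        ((abs_add_le _ _).trans (add_le_add (hR x) h1))).trans ?_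
      refine mul_le_mul_of_nonneg_left ?_ hC0
      nlinarith [hρ x, sq_nonneg (φ x)]
    exact tsum_of_norm_bounded ((summable_weight_mul hφ hφ).mul_left C).hasSum hle
  have hp2 : 2 < p := by linarith
  rw [((summable_prim hp2 (Submodule.add_mem _ hu hφ)).sub (summable_prim hp2 hu)).tsum_sub
      (summable_nonlin_mul hp2 hu hφ),
    (summable_prim hp2 (Submodule.add_mem _ hu hφ)).tsum_sub (summable_prim hp2 hu)] at hsum
  have hE := gradInt_comb hu hφ 1 1
  have hP := mass_comb hu hφ 1 1
  simp only [one_smul] at hE hP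
  have hX := gradInt_sq_le hu hφ
  have hY := gradInt_self_nonneg φ
  have hP0 := mass_self_nonneg hρ φ
  rw [energy, energy, pairing, hE, hP]
  generalize gradInt u φ = X at *
  generalize gradInt u u = Z at *
  generalize gradInt φ φ = Y at *
  generalize mass ρ φ φ = P at *
  generalize mass ρ u u = P1 at *
  generalize mass ρ u φ = P2 at *
  obtain ⟨hl, hr⟩ := abs_le.1 hsum
  have hYK : Y ^ 2 ≤ K * Y := by nlinarith
  -- The left side is the part of (Z + 2X + Y)² beyond its linearization Z² + 4ZX. Cauchy-Schwarz X²
  -- ≤ ZY and Y² ≤ KY make it linear in Y.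
  have hq : |4 * X ^ 2 + Y ^ 2 + 4 * X * Y + 2 * Z * Y| ≤ (8 * Z + 3 * K) * Y := by
    rw [abs_le]
    constructor <;> nlinarith [sq_nonneg (X + Y), sq_nonneg (X - Y), mul_nonneg hZ hY,
      mul_nonneg hK hY]
  obtain ⟨ql, qr⟩ := abs_le.1 hq
  have ql' := mul_le_mul_of_nonneg_left ql (show 0 ≤ b / 4 by positivity)
  have qr' := mul_le_mul_of_nonneg_left qr (show 0 ≤ b / 4 by positivity)
  have n1 : 0 ≤ a / 2 * P := by positivity
  have n2 : 0 ≤ C * Y := by positivity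
  have n3 : 0 ≤ b / 4 * (8 * Z + 3 * K) * P := by positivity
  have n4 : 0 ≤ a / 2 * Y := by positivity
  rw [abs_le]
  constructor <;> nlinarith

end

/-! ### Translation between the stated functional on `HSpace` and the weighted energy. -/

/-- The weight `λ h + 1`. -/
def weight (h : V → ℝ) (lam : ℝ) (x : V) : ℝ := lam * h x + 1

section

variable {a b p lam : ℝ} {h u φ : V → ℝ} {hρ : ∀ x, 1 ≤ weight h lam x}

/-- The lattice has bounded degree, so square-summability already gives finite Dirichlet energy
(`mem_H1_of_hasSum`). -/
theorem mem_HSpace_iff (hh : ∀ x, 0 ≤ h x) (hlam : 0 ≤ lam) :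
    u ∈ HSpace h lam ↔ u ∈ weightedL2 (weight h lam) hρ := by
  constructor
  · rintro ⟨h1, h2⟩
    have h3 : Summable fun x => u x ^ 2 := Summable.of_nonneg_of_le (fun x => sq_nonneg _)
      (fun x => le_add_of_nonneg_left (gradForm_self_nonneg u x)) h1
    exact (h2.add h3).congr fun x => by rw [weight]; ring
  · intro hu
    refine ⟨(mem_H1_of_hasSum (summable_sq hu).hasSum).1,
      Summable.of_nonneg_of_le (fun x => ?_) (fun x => ?_) hu⟩
    · exact mul_nonneg (mul_nonneg hlam (hh x)) (sq_nonneg _)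
    · rw [weight]
      nlinarith [sq_nonneg (u x)]

theorem tsum_quadratic (hu : u ∈ weightedL2 (weight h lam) hρ)
    (hφ : φ ∈ weightedL2 (weight h lam) hρ) :
    ∑' x, (a * gradForm u φ x + (lam * h x + 1) * u x * φ x) =
      a * gradInt u φ + mass (weight h lam) u φ := by
  rw [gradInt, mass, ← tsum_mul_left]
  exact ((summable_gradForm hu hφ).mul_left a).tsum_add (summable_weight_mul hu hφ)

theorem tsum_quadratic_self (hu : u ∈ weightedL2 (weight h lam) hρ) :
    ∑' x, (a * gradForm u u x + (lam * h x + 1) * u x ^ 2) =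
      a * gradInt u u + mass (weight h lam) u u := by
  rw [← tsum_quadratic hu hu]
  exact tsum_congr fun x => by ring

theorem J_eq (hp : 2 < p) (hu : u ∈ weightedL2 (weight h lam) hρ) :
    J a b p h lam u = energy a b p (weight h lam) u := by
  rw [J, energy, tsum_quadratic_self hu, tsum_prim hp hu]
  simp only [logMass, lpMass, nonlin_mul_self hp]
  ring

theorem dJ_eq (hu : u ∈ weightedL2 (weight h lam) hρ) (hφ : φ ∈ weightedL2 (weight h lam) hρ) :
    dJ a b p h lam u φ = pairing a b p (weight h lam) u φ := by
  rw [dJ, pairing, tsum_quadratic hu hφ]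
  refine congrArg _ (tsum_congr fun x => ?_)
  rw [nonlin]
  ring

theorem hNorm_sq (ha : 0 ≤ a) (hu : u ∈ weightedL2 (weight h lam) hρ) :
    hNorm a h lam u ^ 2 = a * gradInt u u + mass (weight h lam) u u := by
  rw [hNorm, tsum_quadratic_self hu, Real.sq_sqrt]
  exact add_nonneg (mul_nonneg ha (gradInt_self_nonneg u)) (mass_self_nonneg hρ u)

theorem exists_J_taylor (ha : 0 < a) (hb : 0 ≤ b) (hp : 4 < p)
    (hu : u ∈ weightedL2 (weight h lam) hρ) :
    ∃ C, 0 ≤ C ∧ ∀ φ ∈ weightedL2 (weight h lam) hρ, hNorm a h lam φ ≤ 1 →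
      |J a b p h lam (u + φ) - J a b p h lam u - dJ a b p h lam u φ| ≤
        C * hNorm a h lam φ ^ 2 := by
  obtain ⟨C, hC, H⟩ := exists_energy_taylor (K := 1 / a) ha.le hb hp hu (by positivity)
  refine ⟨C * (1 / a + 1), by positivity, fun φ hφ h1 => ?_⟩
  have hn := hNorm_sq ha.le hφ
  have hn0 : 0 ≤ hNorm a h lam φ := Real.sqrt_nonneg _
  have hn1 : hNorm a h lam φ ^ 2 ≤ 1 := pow_le_one₀ hn0 h1
  have hE := gradInt_self_nonneg φ
  have hP := mass_self_nonneg hρ φ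
  have hE1 : gradInt φ φ ≤ 1 / a * hNorm a h lam φ ^ 2 := by
    rw [hn]
    have : 1 / a * (a * gradInt φ φ) = gradInt φ φ := by field_simp
    rw [mul_add, this]
    have : 0 ≤ 1 / a * mass (weight h lam) φ φ := by positivity
    linarith
  have hP1 : mass (weight h lam) φ φ ≤ hNorm a h lam φ ^ 2 := by
    rw [hn]
    nlinarith
  rw [J_eq (by linarith) (Submodule.add_mem _ hu hφ), J_eq (by linarith) hu, dJ_eq hu hφ]
  refine (H φ hφ (hE1.trans ?_) (hP1.trans hn1)).trans ?_
  · exact mul_le_of_le_one_right (by positivity) hn1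
  · rw [mul_assoc]
    exact mul_le_mul_of_nonneg_left (by linarith) hC

/-- The quadratic Taylor remainder identifies `dJ` as the Fréchet derivative. In the forward
direction the estimate is applied to t φ and divided by t. -/
theorem isCriticalPoint_iff (ha : 0 < a) (hb : 0 ≤ b) (hp : 4 < p) (hh : ∀ x, 0 ≤ h x)
    (hlam : 0 ≤ lam) (hu : u ∈ weightedL2 (weight h lam) hρ) :
    IsCriticalPoint a b p h lam u ↔ ∀ φ ∈ HSpace h lam, dJ a b p h lam u φ = 0 := by
  obtain ⟨C, hC, H⟩ := exists_J_taylor ha hb hp hu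
  constructor
  · intro hcrit φ hφ
    rw [mem_HSpace_iff (hρ := hρ) hh hlam] at hφ
    have hn0 : 0 ≤ hNorm a h lam φ := Real.sqrt_nonneg _
    set n := hNorm a h lam φ with hn
    have hsmul : ∀ t : ℝ, 0 ≤ t → hNorm a h lam (t • φ) = t * n := by
      intro t ht
      have e1 := hNorm_sq ha.le (Submodule.smul_mem _ t hφ)
      have e2 := hNorm_sq ha.le hφ
      simp only [gradInt_smul_left, gradInt_smul_right, mass_smul_left, mass_smul_right] at e1
      have : hNorm a h lam (t • φ) ^ 2 = (t * n) ^ 2 := by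
        rw [e1, mul_pow, hn, e2]
        ring
      exact (sq_eq_sq₀ (Real.sqrt_nonneg _) (by positivity)).1 this
    have hlim : ∀ ε > 0, |dJ a b p h lam u φ| ≤ ε := by
      intro ε hε
      obtain ⟨δ, hδ, hcr⟩ := hcrit (ε / (2 * (n + 1))) (by positivity)
      -- The three bounds ensure, in turn, that t φ lies in the Taylor range, that its norm is below
      -- δ, and that the quadratic remainder is at most tε/2.
      set t := min (min (1 / (n + 1)) (δ / (2 * (n + 1)))) (ε / (2 * (C * n ^ 2 + 1))) with ht
      have ht0 : 0 < t := by positivity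
      have ht1 : t ≤ 1 / (n + 1) := (min_le_left _ _).trans (min_le_left _ _)
      have ht2 : t ≤ δ / (2 * (n + 1)) := (min_le_left _ _).trans (min_le_right _ _)
      have ht3 : t ≤ ε / (2 * (C * n ^ 2 + 1)) := min_le_right _ _
      rw [le_div_iff₀ (by positivity)] at ht1 ht2 ht3
      have htφ := Submodule.smul_mem _ t hφ
      have k1 := H _ htφ (by rw [hsmul t ht0.le]; nlinarith)
      have k2 := hcr _ ((mem_HSpace_iff hh hlam).2 htφ) (by rw [hsmul t ht0.le]; nlinarith)
      rw [hsmul t ht0.le] at k1 k2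
      rw [dJ_eq hu htφ, pairing_smul, ← dJ_eq hu hφ] at k1
      have k3 : |t * dJ a b p h lam u φ| ≤
          C * (t * n) ^ 2 + ε / (2 * (n + 1)) * (t * n) := by
        have := abs_sub_abs_le_abs_sub (t * dJ a b p h lam u φ)
          (J a b p h lam (u + t • φ) - J a b p h lam u)
        rw [abs_sub_comm (t * _)] at this
        linarith
      rw [abs_mul, abs_of_pos ht0] at k3
      have k4 : ε / (2 * (n + 1)) * (t * n) ≤ t * (ε / 2) := by
        rw [div_mul_eq_mul_div, div_le_iff₀ (by positivity)]
        nlinarith [mul_pos ht0 hε]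
      have k5 : C * (t * n) ^ 2 ≤ t * (ε / 2) := by nlinarith
      have k6 : t * |dJ a b p h lam u φ| ≤ t * ε := by linarith
      exact le_of_mul_le_mul_left k6 ht0
    exact abs_nonpos_iff.1 (le_of_forall_pos_le_add fun ε hε => by simpa using hlim ε hε)
  · intro hz ε hε
    refine ⟨min 1 (ε / (C + 1)), by positivity, fun φ hφ hn => ?_⟩
    have h1 := H φ ((mem_HSpace_iff hh hlam).1 hφ) (hn.le.trans (min_le_left _ _))
    rw [hz φ hφ, sub_zero] at h1
    have hn0 : 0 ≤ hNorm a h lam φ := Real.sqrt_nonneg _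
    have h2 := hn.le.trans (min_le_right _ _)
    rw [le_div_iff₀ (by positivity)] at h2
    refine h1.trans ?_
    rw [sq, ← mul_assoc]
    exact mul_le_mul_of_nonneg_right (by nlinarith) hn0

end

end

/-! ### Fibering: the two-variable function obtained on a cone. -/

noncomputable section

/-- The coefficients of the energy restricted to a two-dimensional cone `s f + t g`. -/
structure FiberData where
  (A K B P Q S L S' L' : ℝ)

namespace FiberData

/-- Exchange of the two generators. -/
def swap (d : FiberData) : FiberData :=
  ⟨d.B, d.K, d.A, d.Q, d.P, d.S', d.L', d.S, d.L⟩

/-- The Dirichlet energy on the cone. -/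
def grad (d : FiberData) (s t : ℝ) : ℝ := s ^ 2 * d.A + 2 * (s * t) * d.K + t ^ 2 * d.B

/-- The nonlinear part on a ray. -/
def ray (p S L s : ℝ) : ℝ := S / p * |s| ^ p + L * prim p s

/-- The energy on the cone. -/
def val (a b p : ℝ) (d : FiberData) (s t : ℝ) : ℝ :=
  (1 / 2) * (a * d.grad s t + (s ^ 2 * d.P + t ^ 2 * d.Q)) + b / 4 * d.grad s t ^ 2 -
    ray p d.S d.L s - ray p d.S' d.L' t

/-- The partial derivative of `val` in the first variable. -/
def slope (a b p : ℝ) (d : FiberData) (s t : ℝ) : ℝ :=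
  a * (d.A * s + d.K * t) + d.P * s + b * d.grad s t * (d.A * s + d.K * t) -
    (d.S * (|s| ^ (p - 2) * s) + d.L * nonlin p s)

/-- The sign conditions on the coefficients. -/
structure Admissible (d : FiberData) : Prop where
  A : 0 ≤ d.A
  K : 0 ≤ d.K
  B : 0 ≤ d.B
  P : 0 < d.P
  Q : 0 < d.Q
  L : 0 < d.L
  L' : 0 < d.L'

variable {a b p : ℝ} {d : FiberData}

theorem Admissible.swap (hd : d.Admissible) : d.swap.Admissible :=
  ⟨hd.B, hd.K, hd.A, hd.Q, hd.P, hd.L', hd.L⟩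

theorem grad_swap (d : FiberData) (s t : ℝ) : d.swap.grad t s = d.grad s t := by
  simp only [grad, FiberData.swap]
  ring

theorem val_swap (d : FiberData) (s t : ℝ) : d.swap.val a b p t s = d.val a b p s t := by
  simp only [val, grad_swap]
  simp only [FiberData.swap]
  ring

theorem ray_eq {s : ℝ} (hs : 0 ≤ s) (S L : ℝ) :
    ray p S L s = s ^ p * (S / p + (Real.log (s ^ 2) / p - 2 / p ^ 2) * L) := by
  rw [ray, prim, abs_of_nonneg hs]
  ring

theorem continuous_ray (hp : 3 < p) (S L : ℝ) : Continuous (ray p S L) :=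
  (continuous_const.mul (continuous_abs_rpow (by linarith))).add
    (continuous_const.mul (continuous_prim hp))

theorem continuous_val (hp : 3 < p) (d : FiberData) :
    Continuous fun z : ℝ × ℝ => d.val a b p z.1 z.2 := by
  unfold val grad
  have h1 := (continuous_ray hp d.S d.L).comp (continuous_fst (X := ℝ) (Y := ℝ))
  have h2 := (continuous_ray hp d.S' d.L').comp (continuous_snd (X := ℝ) (Y := ℝ))
  refine (Continuous.sub ?_ h1).sub h2
  fun_prop

theorem hasDerivAt_val (hp : 3 < p) (d : FiberData) {s : ℝ} (hs : s ≠ 0) (t : ℝ) :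
    HasDerivAt (fun s => d.val a b p s t) (d.slope a b p s t) s := by
  have h2 : HasDerivAt (fun s : ℝ => s ^ 2) (2 * s) s := by simpa using hasDerivAt_pow 2 s
  have h1 : HasDerivAt (fun s : ℝ => 2 * (s * t)) (2 * t) s := by
    simpa using ((hasDerivAt_id s).mul_const t).const_mul 2
  have hg : HasDerivAt (fun s => d.grad s t) (2 * (d.A * s + d.K * t)) s := by
    refine (((h2.mul_const d.A).add (h1.mul_const d.K)).add_const (t ^ 2 * d.B)).congr_deriv ?_
    ring
  have hr : HasDerivAt (ray p d.S d.L) (d.S * (|s| ^ (p - 2) * s) + d.L * nonlin p s) s := by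
    refine (((hasDerivAt_abs_rpow hs).const_mul (d.S / p)).add
      ((hasDerivAt_prim hp s).const_mul d.L)).congr_deriv ?_
    have : p ≠ 0 := by linarith
    field_simp
  have hq := (h2.mul_const d.P).add_const (t ^ 2 * d.Q)
  refine (((((hg.const_mul a).add hq).const_mul (1 / 2)).add
    ((hg.pow 2).const_mul (b / 4))).sub hr).sub_const (ray p d.S' d.L' t) |>.congr_deriv ?_
  rw [slope]
  push_cast
  ring

/-- An interior maximum over a rectangle is a critical point. -/
theorem slope_eq_zero_of_isMax (hp : 3 < p) (d : FiberData) {s₁ s₂ t₁ t₂ s t : ℝ}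
    (hs₁ : 0 ≤ s₁) (ht₁ : 0 ≤ t₁) (hs : s ∈ Set.Ioo s₁ s₂) (ht : t ∈ Set.Ioo t₁ t₂)
    (hmax : ∀ s' ∈ Set.Icc s₁ s₂, ∀ t' ∈ Set.Icc t₁ t₂, d.val a b p s' t' ≤ d.val a b p s t) :
    d.slope a b p s t = 0 ∧ d.swap.slope a b p t s = 0 := by
  constructor
  · refine IsLocalMax.hasDerivAt_eq_zero (f := fun s => d.val a b p s t) ?_
      (hasDerivAt_val hp d (hs₁.trans_lt hs.1).ne' t)
    filter_upwards [Icc_mem_nhds hs.1 hs.2] with s' hs'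
    exact hmax s' hs' t (Set.Ioo_subset_Icc_self ht)
  · refine IsLocalMax.hasDerivAt_eq_zero (f := fun t => d.swap.val a b p t s) ?_
      (hasDerivAt_val hp d.swap (ht₁.trans_lt ht.1).ne' s)
    filter_upwards [Icc_mem_nhds ht.1 ht.2] with t' ht'
    rw [val_swap, val_swap]
    exact hmax s (Set.Ioo_subset_Icc_self hs) t' ht'

/-- Whatever the sign of S, the logarithm drives the coefficient of s^p to infinity, and s^p ≥ s⁴
for s ≥ 1. -/
theorem exists_mul_pow_four_le_ray (hp : 4 < p) (S : ℝ) {L : ℝ} (hL : 0 < L) (D : ℝ) :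
    ∃ R, 1 ≤ R ∧ ∀ s, R ≤ s → D * s ^ 4 ≤ ray p S L s := by
  have hlim : Filter.Tendsto (fun s : ℝ => Real.log (s ^ 2)) Filter.atTop Filter.atTop :=
    Real.tendsto_log_atTop.comp (Filter.tendsto_pow_atTop two_ne_zero)
  obtain ⟨R, hR⟩ := Filter.eventually_atTop.1
    (hlim.eventually_ge_atTop (p * ((max D 0 - S / p) / L + 2 / p ^ 2)))
  refine ⟨max R 1, le_max_right _ _, fun s hs => ?_⟩
  have hs1 : 1 ≤ s := (le_max_right _ _).trans hs
  have hlog := hR s ((le_max_left _ _).trans hs)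
  rw [ray_eq (by linarith)]
  have hp0 : 0 < p := by linarith
  have h1 : (max D 0 - S / p) / L ≤ Real.log (s ^ 2) / p - 2 / p ^ 2 := by
    have := (le_div_iff₀' hp0).2 hlog
    linarith
  rw [div_le_iff₀ hL] at h1
  have h4 : s ^ 4 ≤ s ^ p := by
    have := Real.rpow_le_rpow_of_exponent_le hs1 hp.le
    calc s ^ 4 = s ^ (4 : ℝ) := by norm_cast
      _ ≤ s ^ p := this
  have h0 : 0 ≤ s ^ 4 := by positivity
  calc D * s ^ 4 ≤ max D 0 * s ^ 4 := mul_le_mul_of_nonneg_right (le_max_left _ _) h0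
    _ ≤ max D 0 * s ^ p := mul_le_mul_of_nonneg_left h4 (le_max_right _ _)
    _ = s ^ p * max D 0 := mul_comm _ _
    _ ≤ _ := mul_le_mul_of_nonneg_left (by linarith) (h0.trans h4)

theorem exists_ray_ge (hp : 4 < p) (S : ℝ) {L : ℝ} (hL : 0 < L) :
    ∃ c, 0 ≤ c ∧ ∀ s, 0 ≤ s → -c ≤ ray p S L s := by
  obtain ⟨R, -, hR⟩ := exists_mul_pow_four_le_ray hp S hL 0
  obtain ⟨c, hc0, hc⟩ := exists_bound_of_continuous (continuous_ray (p := p) (by linarith) S L) R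
  refine ⟨c, hc0, fun s hs => ?_⟩
  rcases le_total s R with h | h
  · exact (abs_le.1 (hc s (by rwa [abs_of_nonneg hs]))).1
  · have := hR s h
    linarith

/-- Near 0 the power part is o(s²) and the logarithmic part is nonpositive, so the mass term wins.
-/
theorem exists_ray_lt (hp : 4 < p) (S : ℝ) {L P : ℝ} (hL : 0 ≤ L) (hP : 0 < P) {R : ℝ}
    (hR : 0 < R) : ∃ s, 0 < s ∧ s ≤ R ∧ ray p S L s < 1 / 2 * (s ^ 2 * P) := by
  have hc : Continuous fun s : ℝ => S / p * |s| ^ (p - 2) :=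
    continuous_const.mul (continuous_abs_rpow (by linarith))
  have h0 : S / p * |(0 : ℝ)| ^ (p - 2) < P / 2 := by
    rw [abs_zero, Real.zero_rpow (by linarith)]
    linarith
  obtain ⟨r, hr, h⟩ := Metric.eventually_nhds_iff.1
    (hc.continuousAt.eventually_lt continuousAt_const h0)
  refine ⟨min (min (r / 2) 1) R, by positivity, min_le_right _ _, ?_⟩
  set s := min (min (r / 2) 1) R with hs
  have hs0 : 0 < s := by positivity
  have hsr : s ≤ r / 2 := (min_le_left _ _).trans (min_le_left _ _)
  have hs1 : s ≤ 1 := (min_le_left _ _).trans (min_le_right _ _)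
  have key := h (y := s) (by rw [Real.dist_eq, sub_zero, abs_of_pos hs0]; linarith)
  have hpr := prim_nonpos (p := p) (by linarith) (t := s) (by rwa [abs_of_pos hs0])
  rw [ray, abs_rpow_eq_sub_two (by linarith), ← mul_assoc]
  nlinarith [mul_nonneg hL (neg_nonneg.2 hpr), pow_pos hs0 2]

/-- Leaving the axis gains s²P/2 against a smaller ray term, and the Dirichlet part cannot decrease
because A and K are nonnegative. A maximum therefore avoids the axis. -/
theorem val_lt_of_fst_eq_zero (ha : 0 ≤ a) (hb : 0 ≤ b) (hp : 4 < p) (hd : d.Admissible) {R t : ℝ}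
    (hR : 0 < R) (ht : 0 ≤ t) : ∃ s, 0 < s ∧ s ≤ R ∧ d.val a b p 0 t < d.val a b p s t := by
  obtain ⟨s, hs0, hsR, hs⟩ := exists_ray_lt hp d.S hd.L.le hd.P hR
  refine ⟨s, hs0, hsR, ?_⟩
  have h0 : ray p d.S d.L 0 = 0 := by
    simp [ray, prim_zero (p := p) (by linarith), show p ≠ 0 by linarith]
  have hA := hd.A
  have hK := hd.K
  have hB := hd.B
  have hg0 : 0 ≤ d.grad 0 t := by
    simp only [grad]
    positivity
  have hg : d.grad 0 t ≤ d.grad s t := by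
    have : d.grad s t = d.grad 0 t + (s ^ 2 * d.A + 2 * (s * t) * d.K) := by
      simp only [grad]
      ring
    rw [this]
    exact le_add_of_nonneg_right (by positivity)
  have hg2 := pow_le_pow_left₀ hg0 hg 2
  have h1 := mul_le_mul_of_nonneg_left hg ha
  have h2 := mul_le_mul_of_nonneg_left hg2 (show 0 ≤ b / 4 by positivity)
  simp only [val, h0]
  nlinarith

/-- When R is the larger coordinate, the quadratic and Kirchhoff terms are O(R⁴). The ray in R beats
this, while the other ray is bounded below. -/
theorem exists_val_neg (ha : 0 ≤ a) (hb : 0 ≤ b) (hp : 4 < p) (hd : d.Admissible) :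
    ∃ R₀, 0 < R₀ ∧ ∀ R, R₀ ≤ R → ∀ t, 0 ≤ t → t ≤ R → d.val a b p R t < 0 := by
  obtain ⟨c, hc0, hc⟩ := exists_ray_ge hp d.S' hd.L'
  have hA := hd.A
  have hK := hd.K
  have hB := hd.B
  have hP := hd.P
  have hQ := hd.Q
  obtain ⟨M, hM⟩ : ∃ M, M = d.A + 2 * d.K + d.B := ⟨_, rfl⟩
  have hM0 : 0 ≤ M := by rw [hM]; positivity
  obtain ⟨R₀, hR1, hR₀⟩ := exists_mul_pow_four_le_ray hp d.S hd.L
    (1 / 2 * (a * M + (d.P + d.Q)) + b / 4 * M ^ 2 + c + 1)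
  refine ⟨R₀, by linarith, fun R hR t ht htR => ?_⟩
  have h1R : 1 ≤ R := hR1.trans hR
  have h1 := hR₀ R hR
  have h2 := hc t ht
  have hg0 : 0 ≤ d.grad R t := by
    simp only [grad]
    positivity
  have ht2 : t ^ 2 ≤ R ^ 2 := pow_le_pow_left₀ ht htR 2
  have hRt : R * t ≤ R ^ 2 := by nlinarith
  have hg : d.grad R t ≤ R ^ 2 * M := by
    simp only [grad, hM]
    linarith [mul_le_mul_of_nonneg_right hRt hK, mul_le_mul_of_nonneg_right ht2 hB]
  have hg2 : d.grad R t ^ 2 ≤ (R ^ 2 * M) ^ 2 := pow_le_pow_left₀ hg0 hg 2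
  have hR24 : R ^ 2 ≤ R ^ 4 := pow_le_pow_right₀ h1R (by norm_num)
  have hR4 : 1 ≤ R ^ 4 := one_le_pow₀ h1R
  have k1 := mul_le_mul_of_nonneg_left hg ha
  have k2 := mul_le_mul_of_nonneg_left hg2 (show 0 ≤ b / 4 by positivity)
  have k3 := mul_le_mul_of_nonneg_right ht2 hQ.le
  have k4 := mul_le_mul_of_nonneg_right hR24 (show 0 ≤ 1 / 2 * (a * M + (d.P + d.Q)) by positivity)
  have k5 := mul_le_mul_of_nonneg_left hR4 hc0
  have e : b / 4 * (R ^ 2 * M) ^ 2 = R ^ 4 * (b / 4 * M ^ 2) := by ring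
  simp only [val]
  rw [e] at k2
  linarith

/-- The energy on the cone has a critical point with positive coordinates. -/
theorem exists_slope_eq_zero (ha : 0 ≤ a) (hb : 0 ≤ b) (hp : 4 < p) (hd : d.Admissible) :
    ∃ s t, 0 < s ∧ 0 < t ∧ d.slope a b p s t = 0 ∧ d.swap.slope a b p t s = 0 := by
  obtain ⟨R₁, hR₁, h₁⟩ := exists_val_neg ha hb hp hd
  obtain ⟨R₂, hR₂, h₂⟩ := exists_val_neg ha hb hp hd.swap
  obtain ⟨R, hR⟩ : ∃ R, R = max R₁ R₂ := ⟨_, rfl⟩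
  have hR0 : 0 < R := hR ▸ hR₁.trans_le (le_max_left _ _)
  -- A maximizer over [0, R]² is excluded from all four sides: the axes by `val_lt_of_fst_eq_zero`,
  -- the far sides because the value there is negative while it is 0 at the origin.
  obtain ⟨⟨s, t⟩, ⟨hs, ht⟩, hmax⟩ := ((isCompact_Icc (a := (0 : ℝ)) (b := R)).prod
    (isCompact_Icc (a := (0 : ℝ)) (b := R))).exists_isMaxOn
    ⟨(0, 0), Set.mk_mem_prod ⟨le_rfl, hR0.le⟩ ⟨le_rfl, hR0.le⟩⟩
    (continuous_val (a := a) (b := b) (p := p) (by linarith) d).continuousOn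
  have hmax' : ∀ s' ∈ Set.Icc 0 R, ∀ t' ∈ Set.Icc 0 R, d.val a b p s' t' ≤ d.val a b p s t :=
    fun s' hs' t' ht' => isMaxOn_iff.1 hmax (s', t') (Set.mk_mem_prod hs' ht')
  clear hmax
  replace hs : s ∈ Set.Icc 0 R := hs
  replace ht : t ∈ Set.Icc 0 R := ht
  have h00 : d.val a b p 0 0 = 0 := by
    simp [val, grad, ray, prim_zero (p := p) (by linarith), show p ≠ 0 by linarith]
  have hpos := hmax' 0 ⟨le_rfl, hR0.le⟩ 0 ⟨le_rfl, hR0.le⟩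
  rw [h00] at hpos
  have hs0 : 0 < s := by
    refine hs.1.lt_of_ne fun h0 => ?_
    obtain ⟨s', hs'0, hs'R, h⟩ := val_lt_of_fst_eq_zero ha hb hp hd hR0 ht.1
    rw [h0] at h
    exact (hmax' s' ⟨hs'0.le, hs'R⟩ t ht).not_gt h
  have ht0 : 0 < t := by
    refine ht.1.lt_of_ne fun h0 => ?_
    obtain ⟨t', ht'0, ht'R, h⟩ := val_lt_of_fst_eq_zero ha hb hp hd.swap hR0 hs.1
    rw [h0, val_swap, val_swap] at h
    exact (hmax' s hs t' ⟨ht'0.le, ht'R⟩).not_gt h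
  have hsR : s < R := by
    refine hs.2.lt_of_ne fun h0 => ?_
    have := h₁ s (by rw [h0, hR]; exact le_max_left _ _) t ht.1 (by rw [h0]; exact ht.2)
    linarith
  have htR : t < R := by
    refine ht.2.lt_of_ne fun h0 => ?_
    have := h₂ t (by rw [h0, hR]; exact le_max_right _ _) s hs.1 (by rw [h0]; exact hs.2)
    rw [val_swap] at this
    linarith
  have key := slope_eq_zero_of_isMax (p := p) (by linarith) d (le_refl 0) (le_refl 0)
    ⟨hs0, hsR⟩ ⟨ht0, htR⟩ hmax'
  exact ⟨s, t, hs0, ht0, key⟩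

theorem slope_one (d : FiberData) : d.slope a b p 1 1 =
    a * (d.A + d.K) + d.P + b * (d.A + 2 * d.K + d.B) * (d.A + d.K) - d.S := by
  simp [slope, grad, nonlin]

/-- The fibering inequality. -/
theorem val_le (ha : 0 ≤ a) (hb : 0 ≤ b) (hp : 4 < p) (hd : d.Admissible) {s t : ℝ} (hs : 0 ≤ s)
    (ht : 0 ≤ t) :
    d.val a b p s t + (1 - s ^ p) / p * d.slope a b p 1 1 +
      (1 - t ^ p) / p * d.swap.slope a b p 1 1 +
      (((1 - s ^ 2) / 2 - (1 - s ^ p) / p) * d.P + ((1 - t ^ 2) / 2 - (1 - t ^ p) / p) * d.Q) ≤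
      d.val a b p 1 1 := by
  have hp0 : 0 < p := by linarith
  -- The difference of the two sides is L/p² times the nonnegative expression in `log_scale_nonneg`.
  have ray_le : ∀ {s : ℝ}, 0 ≤ s → ∀ S L, 0 ≤ L →
      ray p S L 1 + (-1) * ray p S L s ≤ (1 - s ^ p) / p * S := by
    intro s hs S L hL
    have h := mul_nonneg (div_nonneg hL (sq_nonneg p)) (log_scale_nonneg hs hp0)
    rw [ray_eq hs, ray_eq zero_le_one, one_pow, Real.log_one, Real.one_rpow]
    have e : L / p ^ 2 * (2 * (1 - s ^ p) + p * (s ^ p * Real.log (s ^ 2))) =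
        (1 - s ^ p) / p * S - (1 * (S / p + (0 / p - 2 / p ^ 2) * L) +
          -1 * (s ^ p * (S / p + (Real.log (s ^ 2) / p - 2 / p ^ 2) * L))) := by
      field_simp
      ring
    linarith
  have r1 := ray_le hs d.S d.L hd.L.le
  have r2 := ray_le ht d.S' d.L' hd.L'.le
  have q2 : ∀ {s : ℝ}, 0 ≤ s → (1 - s ^ p) / p ≤ (1 - s ^ 2) / 2 := fun hs => by
    have := one_sub_rpow_div_le (q := 2) (p := p) hs two_pos (by linarith)
    rwa [Real.rpow_two] at this
  have q4 : ∀ {s : ℝ}, 0 ≤ s → (1 - s ^ p) / p ≤ (1 - s ^ 4) / 4 := fun {s} hs => by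
    have := one_sub_rpow_div_le (q := 4) (p := p) hs four_pos hp.le
    rwa [show s ^ (4 : ℝ) = s ^ 4 by norm_cast] at this
  have hX : 0 ≤ d.A + d.K := add_nonneg hd.A hd.K
  have hY : 0 ≤ d.B + d.K := add_nonneg hd.B hd.K
  have hT0 : 0 ≤ d.grad s t := by
    have := hd.A
    have := hd.B
    have := hd.K
    simp only [grad]
    positivity
  -- 2st ≤ s² + t² absorbs the cross term into the weights X = A + K and Y = B + K appearing in the
  -- two slopes.
  have hT : d.grad s t ≤ s ^ 2 * (d.A + d.K) + t ^ 2 * (d.B + d.K) := by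
    simp only [grad]
    nlinarith [mul_nonneg hd.K (sq_nonneg (s - t))]
  -- Cauchy-Schwarz with weights X and Y separates the variables, so the scalar inequality with
  -- exponent 4 applies to each.
  have hT2 : d.grad s t ^ 2 ≤
      (d.A + d.K + (d.B + d.K)) * (s ^ 4 * (d.A + d.K) + t ^ 4 * (d.B + d.K)) := by
    refine (pow_le_pow_left₀ hT0 hT 2).trans ?_
    nlinarith [mul_nonneg (mul_nonneg hX hY) (sq_nonneg (s ^ 2 - t ^ 2))]
  have hG : d.grad 1 1 = d.A + d.K + (d.B + d.K) := by
    simp only [grad]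
    ring
  simp only [slope_one, val, hG]
  simp only [FiberData.swap]
  generalize hX' : d.A + d.K = X at *
  generalize hY' : d.B + d.K = Y at *
  generalize hσ : (1 - s ^ p) / p = σ at *
  generalize hτ : (1 - t ^ p) / p = τ at *
  have m1 := mul_le_mul_of_nonneg_left (add_le_add (mul_le_mul_of_nonneg_right (q2 hs) hX)
    (mul_le_mul_of_nonneg_right (q2 ht) hY)) ha
  have m2 := mul_le_mul_of_nonneg_left hT ha
  have hXY : 0 ≤ b * (X + Y) := by positivity
  have m3 := mul_le_mul_of_nonneg_left (add_le_add (mul_le_mul_of_nonneg_right (q4 hs) hX)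
    (mul_le_mul_of_nonneg_right (q4 ht) hY)) hXY
  have m4 := mul_le_mul_of_nonneg_left hT2 (show 0 ≤ b / 4 by positivity)
  rw [hσ, hτ] at m1 m3
  have e1 : d.A + 2 * d.K + d.B = X + Y := by rw [← hX', ← hY']; ring
  have e2 : d.B + 2 * d.K + d.A = X + Y := by rw [← hX', ← hY']; ring
  rw [e1, e2]
  linarith

theorem rescale_nonneg {s : ℝ} (hs : 0 ≤ s) (hp : 2 < p) :
    0 ≤ (1 - s ^ 2) / 2 - (1 - s ^ p) / p := by
  rcases eq_or_ne s 1 with rfl | h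
  · simp
  · linarith [one_sub_rpow_div_lt hs h hp]

theorem val_le_of_slope_eq_zero (ha : 0 ≤ a) (hb : 0 ≤ b) (hp : 4 < p) (hd : d.Admissible)
    (h1 : d.slope a b p 1 1 = 0) (h2 : d.swap.slope a b p 1 1 = 0) {s t : ℝ} (hs : 0 ≤ s)
    (ht : 0 ≤ t) : d.val a b p s t ≤ d.val a b p 1 1 := by
  have h := val_le ha hb hp hd hs ht
  rw [h1, h2] at h
  have := mul_nonneg (rescale_nonneg hs (show 2 < p by linarith)) hd.P.le
  have := mul_nonneg (rescale_nonneg ht (show 2 < p by linarith)) hd.Q.le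
  linarith

theorem val_lt_of_slope_eq_zero (ha : 0 ≤ a) (hb : 0 ≤ b) (hp : 4 < p) (hd : d.Admissible)
    (h1 : d.slope a b p 1 1 = 0) (h2 : d.swap.slope a b p 1 1 = 0) {s t : ℝ} (hs : 0 ≤ s)
    (ht : 0 ≤ t) (hne : s ≠ 1 ∨ t ≠ 1) : d.val a b p s t < d.val a b p 1 1 := by
  have h := val_le ha hb hp hd hs ht
  rw [h1, h2] at h
  have hp2 : 2 < p := by linarith
  rcases hne with hne | hne
  · have := mul_pos (sub_pos.2 (one_sub_rpow_div_lt hs hne hp2)) hd.P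
    have := mul_nonneg (rescale_nonneg ht hp2) hd.Q.le
    linarith
  · have := mul_nonneg (rescale_nonneg hs hp2) hd.P.le
    have := mul_pos (sub_pos.2 (one_sub_rpow_div_lt ht hne hp2)) hd.Q
    linarith

/-- If the larger coordinate s exceeded 1, s times the quadratic and Kirchhoff part of the slope
would be at most s⁴S, by the sign of the slope at (1, 1). The critical equation equates it with
s^p(S + L log s²), which is strictly larger. -/
theorem fst_le_one (ha : 0 ≤ a) (hb : 0 ≤ b) (hp : 4 < p) (hd : d.Admissible)
    (h1 : d.slope a b p 1 1 ≤ 0) {s t : ℝ} (hs : 0 < s) (ht : 0 < t) (hts : t ≤ s)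
    (h : d.slope a b p s t = 0) : s ≤ 1 := by
  by_contra! hs1
  have hA := hd.A
  have hK := hd.K
  have hB := hd.B
  rw [slope_one] at h1
  have hlog : 0 < Real.log (s ^ 2) := Real.log_pos (one_lt_pow₀ hs1 two_ne_zero)
  have hsp : 0 < s ^ p := Real.rpow_pos_of_pos hs p
  have h4 : s ^ 4 ≤ s ^ p := by
    calc s ^ 4 = s ^ (4 : ℝ) := by norm_cast
      _ ≤ s ^ p := Real.rpow_le_rpow_of_exponent_le hs1.le hp.le
  have e : s * (a * (d.A * s + d.K * t) + d.P * s + b * d.grad s t * (d.A * s + d.K * t)) =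
      s ^ p * (d.S + d.L * Real.log (s ^ 2)) := by
    have e1 := abs_rpow_eq_sub_two (p := p) (by linarith) s
    rw [abs_of_pos hs] at e1
    rw [slope, nonlin, abs_of_pos hs] at h
    rw [e1]
    linear_combination s * h
  have k1 : d.A * s + d.K * t ≤ s * (d.A + d.K) := by nlinarith
  have k10 : 0 ≤ d.A * s + d.K * t := by positivity
  have k2 : d.grad s t ≤ s ^ 2 * (d.A + 2 * d.K + d.B) := by
    simp only [grad]
    have : s * t ≤ s ^ 2 := by nlinarith
    have : t ^ 2 ≤ s ^ 2 := pow_le_pow_left₀ ht.le hts 2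
    nlinarith
  have k3 : b * d.grad s t * (d.A * s + d.K * t) ≤
      b * (s ^ 2 * (d.A + 2 * d.K + d.B)) * (s * (d.A + d.K)) :=
    mul_le_mul (mul_le_mul_of_nonneg_left k2 hb) k1 k10 (by positivity)
  have k4 := mul_le_mul_of_nonneg_left k1 ha
  have k5 := mul_le_mul_of_nonneg_left (add_le_add (add_le_add_left k4 (d.P * s)) k3) hs.le
  have h24 : s ^ 2 ≤ s ^ 4 := pow_le_pow_right₀ hs1.le (by norm_num)
  have k6 : s ^ 2 * (a * (d.A + d.K) + d.P) ≤ s ^ 4 * (a * (d.A + d.K) + d.P) :=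
    mul_le_mul_of_nonneg_right h24 (by have := hd.P; positivity)
  have hS : 0 < d.S := by
    have := hd.P
    have : 0 ≤ a * (d.A + d.K) := by positivity
    have : 0 ≤ b * (d.A + 2 * d.K + d.B) * (d.A + d.K) := by positivity
    linarith
  have k7 := mul_le_mul_of_nonneg_left h1 (show 0 ≤ s ^ 4 by positivity)
  have k8 := mul_le_mul_of_nonneg_right h4 hS.le
  have k9 := mul_pos hsp (mul_pos hd.L hlog)
  rw [e] at k5
  nlinarith

/-- If both slopes at `(1, 1)` are nonpositive, a positive critical point lies in `(0, 1]²`. -/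
theorem le_one_of_slope_nonpos (ha : 0 ≤ a) (hb : 0 ≤ b) (hp : 4 < p) (hd : d.Admissible)
    (h1 : d.slope a b p 1 1 ≤ 0) (h2 : d.swap.slope a b p 1 1 ≤ 0) {s t : ℝ} (hs : 0 < s)
    (ht : 0 < t) (hst : d.slope a b p s t = 0) (hts : d.swap.slope a b p t s = 0) :
    s ≤ 1 ∧ t ≤ 1 := by
  rcases le_total t s with h | h
  · have := fst_le_one ha hb hp hd h1 hs ht h hst
    exact ⟨this, h.trans this⟩
  · have := fst_le_one ha hb hp hd.swap h2 ht hs h hts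
    exact ⟨h.trans this, this⟩

end FiberData

end

/-! ### The sign-changing Nehari set and projections onto it. -/

noncomputable section

/-- The coefficients of the energy on the cone spanned by `f` and `g`. -/
def coneData (p : ℝ) (ρ f g : V → ℝ) : FiberData :=
  ⟨gradInt f f, gradInt f g, gradInt g g, mass ρ f f, mass ρ g g, logMass p f, lpMass p f,
    logMass p g, lpMass p g⟩

/-- Nonzero functions of opposite signs with disjoint supports. -/
structure SignedPair (ρ : V → ℝ) (hρ : ∀ x, 1 ≤ ρ x) (f g : V → ℝ) : Prop where
  mem_left : f ∈ weightedL2 ρ hρ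
  mem_right : g ∈ weightedL2 ρ hρ
  nonneg : ∀ x, 0 ≤ f x
  nonpos : ∀ x, g x ≤ 0
  disjoint : ∀ x, f x * g x = 0
  left_ne : f ≠ 0
  right_ne : g ≠ 0

/-- The sign-changing Nehari set with weight `ρ`. -/
def nodalSet (a b p : ℝ) (ρ : V → ℝ) (hρ : ∀ x, 1 ≤ ρ x) : Set (V → ℝ) :=
  {u | u ∈ weightedL2 ρ hρ ∧ posPart u ≠ 0 ∧ negPart u ≠ 0 ∧
    pairing a b p ρ u (posPart u) = 0 ∧ pairing a b p ρ u (negPart u) = 0}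

variable {a b p : ℝ} {ρ : V → ℝ} {hρ : ∀ x, 1 ≤ ρ x} {u f g : V → ℝ}

theorem coneData_swap (p : ℝ) (ρ f g : V → ℝ) : (coneData p ρ f g).swap = coneData p ρ g f := by
  simp only [coneData, FiberData.swap, gradInt_comm g f]

theorem smul_disjoint (h : ∀ x, f x * g x = 0) (s t : ℝ) (x : V) :
    (s • f) x * (t • g) x = 0 := by
  simp only [Pi.smul_apply, smul_eq_mul]
  linear_combination s * t * h x

theorem energy_comb (hp : 2 < p) (hf : f ∈ weightedL2 ρ hρ) (hg : g ∈ weightedL2 ρ hρ)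
    (h : ∀ x, f x * g x = 0) {s t : ℝ} (hs : 0 ≤ s) (ht : 0 ≤ t) :
    energy a b p ρ (s • f + t • g) = (coneData p ρ f g).val a b p s t := by
  rw [energy, tsum_prim_add_of_disjoint hp (Submodule.smul_mem _ s hf)
    (Submodule.smul_mem _ t hg) (smul_disjoint h s t), gradInt_comb hf hg, mass_comb hf hg,
    tsum_prim_smul hp hf hs, tsum_prim_smul hp hg ht, mass_eq_zero_of_disjoint h, FiberData.val,
    FiberData.ray_eq hs, FiberData.ray_eq ht]
  simp only [FiberData.grad, coneData]
  ring

theorem pairing_comb (hp : 2 < p) (hf : f ∈ weightedL2 ρ hρ) (hg : g ∈ weightedL2 ρ hρ)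
    (h : ∀ x, f x * g x = 0) {s : ℝ} (hs : 0 ≤ s) (t : ℝ) :
    pairing a b p ρ (s • f + t • g) (s • f) = s * (coneData p ρ f g).slope a b p s t := by
  rw [pairing_of_disjoint (Submodule.smul_mem _ s hf) (Submodule.smul_mem _ t hg)
    (smul_disjoint h s t), logMass_smul hp hf hs, FiberData.slope]
  simp only [gradInt_smul_left, gradInt_smul_right, mass_smul_left, mass_smul_right, coneData,
    FiberData.grad]
  have e1 := abs_rpow_eq_sub_two hp s
  rw [abs_of_nonneg hs] at e1
  rw [nonlin, abs_of_nonneg hs, e1]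
  ring

theorem pairing_comb_right (hp : 2 < p) (hf : f ∈ weightedL2 ρ hρ) (hg : g ∈ weightedL2 ρ hρ)
    (h : ∀ x, f x * g x = 0) (s : ℝ) {t : ℝ} (ht : 0 ≤ t) :
    pairing a b p ρ (s • f + t • g) (t • g) = t * (coneData p ρ f g).swap.slope a b p t s := by
  rw [add_comm, coneData_swap]
  exact pairing_comb hp hg hf (fun x => by rw [mul_comm]; exact h x) ht s

theorem signedPair_parts (hu : u ∈ weightedL2 ρ hρ) (h1 : posPart u ≠ 0) (h2 : negPart u ≠ 0) :
    SignedPair ρ hρ (posPart u) (negPart u) :=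
  ⟨posPart_mem hu, negPart_mem hu, posPart_nonneg u, negPart_nonpos u, posPart_mul_negPart u,
    h1, h2⟩

namespace SignedPair

theorem smul (h : SignedPair ρ hρ f g) {s t : ℝ} (hs : 0 < s) (ht : 0 < t) :
    SignedPair ρ hρ (s • f) (t • g) :=
  ⟨Submodule.smul_mem _ s h.mem_left, Submodule.smul_mem _ t h.mem_right,
    fun x => mul_nonneg hs.le (h.nonneg x), fun x => mul_nonpos_of_nonneg_of_nonpos ht.le
    (h.nonpos x), smul_disjoint h.disjoint s t, smul_ne_zero hs.ne' h.left_ne,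
    smul_ne_zero ht.ne' h.right_ne⟩

theorem gradInt_nonneg (h : SignedPair ρ hρ f g) : 0 ≤ gradInt f g :=
  tsum_nonneg (gradForm_nonneg_of_disjoint h.nonneg h.nonpos h.disjoint)

theorem admissible (h : SignedPair ρ hρ f g) (hp : 2 < p) : (coneData p ρ f g).Admissible :=
  ⟨gradInt_self_nonneg f, h.gradInt_nonneg, gradInt_self_nonneg g,
    mass_self_pos h.mem_left h.left_ne, mass_self_pos h.mem_right h.right_ne,
    lpMass_pos hp h.mem_left h.left_ne, lpMass_pos hp h.mem_right h.right_ne⟩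

theorem parts (h : SignedPair ρ hρ f g) : posPart (f + g) = f ∧ negPart (f + g) = g :=
  posPart_of_disjoint h.nonneg h.nonpos h.disjoint

/-- Critical points of the energy on the cone belong to the sign-changing Nehari set. -/
theorem comb_mem_nodalSet (h : SignedPair ρ hρ f g) (hp : 2 < p) {s t : ℝ} (hs : 0 < s)
    (ht : 0 < t) (h1 : (coneData p ρ f g).slope a b p s t = 0)
    (h2 : (coneData p ρ f g).swap.slope a b p t s = 0) :
    s • f + t • g ∈ nodalSet a b p ρ hρ := by
  have hst := h.smul hs ht
  refine ⟨Submodule.add_mem _ hst.mem_left hst.mem_right, ?_⟩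
  rw [hst.parts.1, hst.parts.2]
  refine ⟨hst.left_ne, hst.right_ne, ?_, ?_⟩
  · rw [pairing_comb hp h.mem_left h.mem_right h.disjoint hs.le, h1, mul_zero]
  · rw [pairing_comb_right hp h.mem_left h.mem_right h.disjoint s ht.le, h2, mul_zero]

end SignedPair

theorem pairing_posPart (hp : 2 < p) (hu : u ∈ weightedL2 ρ hρ) :
    pairing a b p ρ u (posPart u) =
      (coneData p ρ (posPart u) (negPart u)).slope a b p 1 1 := by
  have := pairing_comb (a := a) (b := b) hp (posPart_mem hu) (negPart_mem hu)
    (posPart_mul_negPart u) zero_le_one 1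
  simpa only [one_smul, posPart_add_negPart, one_mul] using this

theorem pairing_negPart (hp : 2 < p) (hu : u ∈ weightedL2 ρ hρ) :
    pairing a b p ρ u (negPart u) =
      (coneData p ρ (posPart u) (negPart u)).swap.slope a b p 1 1 := by
  have := pairing_comb_right (a := a) (b := b) hp (posPart_mem hu) (negPart_mem hu)
    (posPart_mul_negPart u) 1 zero_le_one
  simpa only [one_smul, posPart_add_negPart, one_mul] using this

theorem energy_parts (hp : 2 < p) (hu : u ∈ weightedL2 ρ hρ) {s t : ℝ} (hs : 0 ≤ s)
    (ht : 0 ≤ t) : energy a b p ρ (s • posPart u + t • negPart u) =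
      (coneData p ρ (posPart u) (negPart u)).val a b p s t :=
  energy_comb hp (posPart_mem hu) (negPart_mem hu) (posPart_mul_negPart u) hs ht

theorem energy_eq_val_one (hp : 2 < p) (hu : u ∈ weightedL2 ρ hρ) : energy a b p ρ u =
    (coneData p ρ (posPart u) (negPart u)).val a b p 1 1 := by
  rw [← energy_parts hp hu zero_le_one zero_le_one, one_smul, one_smul, posPart_add_negPart]

theorem slopes_of_mem_nodalSet (hp : 2 < p) (hu : u ∈ nodalSet a b p ρ hρ) :
    (coneData p ρ (posPart u) (negPart u)).slope a b p 1 1 = 0 ∧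
      (coneData p ρ (posPart u) (negPart u)).swap.slope a b p 1 1 = 0 := by
  obtain ⟨hu, -, -, h1, h2⟩ := hu
  rw [← pairing_posPart hp hu, ← pairing_negPart hp hu]
  exact ⟨h1, h2⟩

/-- A nodal point maximizes the energy on its own cone. This is used for scalings that need not land
in the nodal set. -/
theorem energy_parts_le (ha : 0 ≤ a) (hb : 0 ≤ b) (hp : 4 < p) (hu : u ∈ nodalSet a b p ρ hρ)
    {s t : ℝ} (hs : 0 ≤ s) (ht : 0 ≤ t) :
    energy a b p ρ (s • posPart u + t • negPart u) ≤ energy a b p ρ u := by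
  have hp2 : 2 < p := by linarith
  obtain ⟨h1, h2⟩ := slopes_of_mem_nodalSet hp2 hu
  rw [energy_eq_val_one hp2 hu.1, energy_parts hp2 hu.1 hs ht]
  exact FiberData.val_le_of_slope_eq_zero ha hb hp
    ((signedPair_parts hu.1 hu.2.1 hu.2.2.1).admissible hp2) h1 h2 hs ht

theorem pairing_self_of_mem_nodalSet (hp : 2 < p) (hu : u ∈ nodalSet a b p ρ hρ) :
    pairing a b p ρ u u = 0 := by
  rw [← pairing_posPart_add_negPart hp hu.1, hu.2.2.2.1, hu.2.2.2.2, add_zero]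

theorem neg_mem_nodalSet (hu : u ∈ nodalSet a b p ρ hρ) : -u ∈ nodalSet a b p ρ hρ := by
  obtain ⟨h0, h1, h2, h3, h4⟩ := hu
  refine ⟨Submodule.neg_mem _ h0, ?_⟩
  rw [posPart_neg, negPart_neg, pairing_neg, pairing_neg]
  exact ⟨neg_ne_zero.2 h2, neg_ne_zero.2 h1, h4, h3⟩

/-- Every ray meets the Nehari manifold. -/
theorem exists_smul_pairing_eq_zero (ha : 0 ≤ a) (hb : 0 ≤ b) (hp : 4 < p)
    (hf : f ∈ weightedL2 ρ hρ) (hf0 : f ≠ 0) :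
    ∃ s : ℝ, 0 < s ∧ pairing a b p ρ (s • f) (s • f) = 0 := by
  have hp2 : 2 < p := by linarith
  -- The one-dimensional problem is embedded in the two-dimensional one with a decoupled dummy
  -- second variable: K = B = 0, Q = L' = 1 and S' = 0.
  obtain ⟨s, t, hs, -, h, -⟩ := FiberData.exists_slope_eq_zero (a := a) (b := b) (p := p)
    (d := ⟨gradInt f f, 0, 0, mass ρ f f, 1, logMass p f, lpMass p f, 0, 1⟩) ha hb hp
    ⟨gradInt_self_nonneg f, le_rfl, le_rfl, mass_self_pos hf hf0, one_pos, lpMass_pos hp2 hf hf0,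
      one_pos⟩
  refine ⟨s, hs, ?_⟩
  rw [pairing_self, logMass_smul hp2 hf hs.le]
  simp only [gradInt_smul_left, gradInt_smul_right, mass_smul_left, mass_smul_right]
  have e1 := abs_rpow_eq_sub_two hp2 s
  simp only [FiberData.slope, FiberData.grad, nonlin] at h
  rw [abs_of_pos hs] at e1 h
  rw [e1]
  linear_combination s * h

/-- Expanding the squared Dirichlet energy of f + g leaves the cross term (b/2)∫|∇f|²∫|∇g|², which
is positive; the remaining extra terms are nonnegative since ∫∇f∇g ≥ 0. -/
theorem energy_add_lt (ha : 0 ≤ a) (hb : 0 < b) (hp : 2 < p) (h : SignedPair ρ hρ f g) :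
    energy a b p ρ f + energy a b p ρ g < energy a b p ρ (f + g) := by
  have hE := gradInt_comb h.mem_left h.mem_right 1 1
  have hP := mass_comb h.mem_left h.mem_right 1 1
  simp only [one_smul, mass_eq_zero_of_disjoint h.disjoint] at hE hP
  rw [energy, energy, energy, tsum_prim_add_of_disjoint hp h.mem_left h.mem_right h.disjoint, hE, hP]
  have h1 := gradInt_self_pos h.mem_left h.left_ne
  have h2 := gradInt_self_pos h.mem_right h.right_ne
  have h3 := h.gradInt_nonneg
  have k1 := mul_pos hb (mul_pos h1 h2)
  have k2 := mul_nonneg ha h3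
  have k3 := mul_nonneg hb.le (mul_nonneg h3 (add_nonneg h1.le h2.le))
  have k4 := mul_nonneg hb.le (sq_nonneg (gradInt f g))
  nlinarith

/-- A nodal point lies strictly above the sum of two Nehari energies. -/
theorem exists_energy_add_lt (ha : 0 ≤ a) (hb : 0 < b) (hp : 4 < p)
    (hu : u ∈ nodalSet a b p ρ hρ) : ∃ f g : V → ℝ, f ∈ weightedL2 ρ hρ ∧ g ∈ weightedL2 ρ hρ ∧
      f ≠ 0 ∧ g ≠ 0 ∧ pairing a b p ρ f f = 0 ∧ pairing a b p ρ g g = 0 ∧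
      energy a b p ρ f + energy a b p ρ g < energy a b p ρ u := by
  have h := signedPair_parts hu.1 hu.2.1 hu.2.2.1
  obtain ⟨s, hs, hs0⟩ := exists_smul_pairing_eq_zero ha hb.le hp h.mem_left h.left_ne
  obtain ⟨t, ht, ht0⟩ := exists_smul_pairing_eq_zero ha hb.le hp h.mem_right h.right_ne
  have hst := h.smul hs ht
  exact ⟨_, _, hst.mem_left, hst.mem_right, hst.left_ne, hst.right_ne, hs0, ht0,
    (energy_add_lt ha hb (by linarith) hst).trans_le (energy_parts_le ha hb.le hp hu hs.le ht.le)⟩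

theorem SignedPair.exists_mem_nodalSet (h : SignedPair ρ hρ f g) (ha : 0 ≤ a) (hb : 0 ≤ b)
    (hp : 4 < p) : ∃ s t : ℝ, 0 < s ∧ 0 < t ∧ s • f + t • g ∈ nodalSet a b p ρ hρ := by
  have hp2 : 2 < p := by linarith
  obtain ⟨s, t, hs, ht, h1, h2⟩ := FiberData.exists_slope_eq_zero ha hb hp (h.admissible hp2)
  exact ⟨s, t, hs, ht, h.comb_mem_nodalSet hp2 hs ht h1 h2⟩

/-- If both partial pairings are nonpositive, the cone meets the sign-changing Nehari set in
`(0, 1]²`. -/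
theorem exists_le_one_mem_nodalSet (ha : 0 ≤ a) (hb : 0 ≤ b) (hp : 4 < p)
    (hu : u ∈ weightedL2 ρ hρ) (hpos : posPart u ≠ 0) (hneg : negPart u ≠ 0)
    (h1 : pairing a b p ρ u (posPart u) ≤ 0) (h2 : pairing a b p ρ u (negPart u) ≤ 0) :
    ∃ s t : ℝ, 0 < s ∧ 0 < t ∧ s ≤ 1 ∧ t ≤ 1 ∧
      s • posPart u + t • negPart u ∈ nodalSet a b p ρ hρ := by
  have hp2 : 2 < p := by linarith
  have h := signedPair_parts hu hpos hneg
  rw [pairing_posPart hp2 hu] at h1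
  rw [pairing_negPart hp2 hu] at h2
  obtain ⟨s, t, hs, ht, k1, k2⟩ := FiberData.exists_slope_eq_zero ha hb hp (h.admissible hp2)
  obtain ⟨hs1, ht1⟩ :=
    FiberData.le_one_of_slope_nonpos ha hb hp (h.admissible hp2) h1 h2 hs ht k1 k2
  exact ⟨s, t, hs, ht, hs1, ht1, h.comb_mem_nodalSet hp2 hs ht k1 k2⟩

end

/-! ### Fatou-type limits and existence of a minimizer. -/

noncomputable section

open Filter Topology

/-- Fatou's lemma for sums whose terms are nonnegative off a finite set. -/
theorem eventually_sub_lt_tsum {U : Filter ℕ} {g : ℕ → V → ℝ} {G : V → ℝ} (D : Finset V)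
    (hnn : ∀ n, ∀ x ∉ D, 0 ≤ g n x) (hs : ∀ n, Summable (g n))
    (hlim : ∀ x, Tendsto (fun n => g n x) U (𝓝 (G x))) (hG : Summable G) {δ : ℝ} (hδ : 0 < δ) :
    ∀ᶠ n in U, ∑' x, G x - δ < ∑' x, g n x := by
  -- F contains D and captures the limit sum up to δ; the terms discarded outside F are nonnegative.
  obtain ⟨F, hF, hDF⟩ := (((tendsto_order.1 hG.hasSum).1 (∑' x, G x - δ) (by linarith)).and
    (eventually_ge_atTop D)).exists
  filter_upwards [(tendsto_order.1 (tendsto_finsetSum F fun x _ => hlim x)).1 _ hF] with n hn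
  exact hn.trans_le ((hs n).sum_le_tsum F fun x hx => hnn n x fun hxD => hx (hDF hxD))

/-- Collects several Fatou losses δ in one continuous expression and lets δ tend to 0 once. -/
theorem le_of_forall_pos_continuous {G : ℝ → ℝ} (hG : Continuous G) {β : ℝ}
    (h : ∀ δ > 0, G δ ≤ β) : G 0 ≤ β :=
  le_of_tendsto (hG.continuousAt.tendsto.mono_left (nhdsWithin_le_nhds (s := Set.Ioi 0)))
    (by filter_upwards [self_mem_nhdsWithin] with δ hδ using h δ hδ)

theorem tendsto_gradForm {U : Filter ℕ} {u v : ℕ → V → ℝ} {u' v' : V → ℝ}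
    (hu : ∀ x, Tendsto (fun n => u n x) U (𝓝 (u' x)))
    (hv : ∀ x, Tendsto (fun n => v n x) U (𝓝 (v' x))) (x : V) :
    Tendsto (fun n => gradForm (u n) (v n) x) U (𝓝 (gradForm u' v' x)) := by
  unfold gradForm
  exact tendsto_const_nhds.mul (tendsto_finsetSum _ fun y _ =>
    ((hu y).sub (hu x)).mul ((hv y).sub (hv x)))

variable {a b p : ℝ} {ρ : V → ℝ} {hρ : ∀ x, 1 ≤ ρ x}

/-- Lower semicontinuity of the energy under pointwise convergence, for functions bounded by `1`
off a finite set. -/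
theorem energy_le_of_tendsto {U : Filter ℕ} [U.NeBot] (ha : 0 ≤ a) (hb : 0 ≤ b) (hp : 4 < p)
    (D : Finset V) {w : ℕ → V → ℝ} {w' : V → ℝ} (hw : ∀ n, w n ∈ weightedL2 ρ hρ)
    (hw' : w' ∈ weightedL2 ρ hρ) (h1 : ∀ n, ∀ x ∉ D, |w n x| ≤ 1)
    (hlim : ∀ x, Tendsto (fun n => w n x) U (𝓝 (w' x))) {β : ℝ}
    (hβ : ∀ᶠ n in U, energy a b p ρ (w n) ≤ β) : energy a b p ρ w' ≤ β := by
  have hp2 : 2 < p := by linarith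
  -- Truncating at 0 keeps the lower bound for the Dirichlet energy nonnegative, so that it may be
  -- squared.
  have key := le_of_forall_pos_continuous (β := β) (G := fun δ =>
    (1 / 2) * (a * (gradInt w' w' - δ) + (mass ρ w' w' - δ)) +
      b / 4 * max (gradInt w' w' - δ) 0 ^ 2 + (∑' x, -prim p (w' x) - δ)) (by fun_prop) ?_
  · simp only [sub_zero, max_eq_left (gradInt_self_nonneg w'), tsum_neg] at key
    rw [energy]
    linarith
  intro δ hδ
  have e1 := eventually_sub_lt_tsum (U := U) D (fun n x _ => gradForm_self_nonneg (w n) x)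
    (fun n => summable_gradForm (hw n) (hw n)) (tendsto_gradForm hlim hlim)
    (summable_gradForm hw' hw') hδ
  have e2 := eventually_sub_lt_tsum (U := U) D (fun n x _ => mass_term_nonneg hρ (w n) x)
    (fun n => summable_weight_mul (hw n) (hw n))
    (fun x => (tendsto_const_nhds.mul (hlim x)).mul (hlim x))
    (summable_weight_mul hw' hw') hδ
  have e3 := eventually_sub_lt_tsum (U := U) (g := fun n x => -prim p (w n x)) D
    (fun n x hx => neg_nonneg.2 (prim_nonpos hp2 (h1 n x hx)))
    (fun n => (summable_prim hp2 (hw n)).neg)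
    (fun x => ((continuous_prim (by linarith)).tendsto _ |>.comp (hlim x)).neg)
    (summable_prim hp2 hw').neg hδ
  obtain ⟨n, h1, h2, h3, h4⟩ := (e1.and (e2.and (e3.and hβ))).exists
  change gradInt w' w' - δ < gradInt (w n) (w n) at h1
  change mass ρ w' w' - δ < mass ρ (w n) (w n) at h2
  have hmax : max (gradInt w' w' - δ) 0 ≤ gradInt (w n) (w n) :=
    max_le h1.le (gradInt_self_nonneg _)
  have k1 := mul_le_mul_of_nonneg_left (pow_le_pow_left₀ (le_max_right _ _) hmax 2)
    (show 0 ≤ b / 4 by positivity)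
  have k2 := mul_le_mul_of_nonneg_left h1.le ha
  rw [tsum_neg (f := fun x => prim p (w n x))] at h3
  rw [energy] at h4
  linarith

theorem gradForm_posPart_nonneg (u : V → ℝ) (x : V) : 0 ≤ gradForm u (posPart u) x := by
  have h := gradForm_add_left (posPart u) (negPart u) (posPart u) x
  rw [posPart_add_negPart, gradForm_comm (negPart u)] at h
  rw [h]
  exact add_nonneg (gradForm_self_nonneg _ x) (gradForm_nonneg_of_disjoint (posPart_nonneg u)
    (negPart_nonpos u) (posPart_mul_negPart u) x)

theorem mul_posPart_nonneg (u : V → ℝ) (x : V) : 0 ≤ u x * posPart u x := by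
  rcases le_total (u x) 0 with h | h
  · simp [posPart, h]
  · exact mul_nonneg h (posPart_nonneg u x)

theorem nonlin_mul_posPart_nonpos (hp : 2 < p) {u : V → ℝ} {x : V} (h : u x ≤ 1) :
    nonlin p (u x) * posPart u x ≤ 0 := by
  rcases le_total (u x) 0 with h0 | h0
  · simp [posPart, h0]
  · rw [posPart, max_eq_left h0]
    exact nonlin_mul_self_nonpos hp (abs_le.2 ⟨by linarith, h⟩)

theorem tendsto_posPart {U : Filter ℕ} {u : ℕ → V → ℝ} {u' : V → ℝ}
    (hlim : ∀ x, Tendsto (fun n => u n x) U (𝓝 (u' x))) (x : V) :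
    Tendsto (fun n => posPart (u n) x) U (𝓝 (posPart u' x)) := (hlim x).max tendsto_const_nhds

theorem tendsto_negPart {U : Filter ℕ} {u : ℕ → V → ℝ} {u' : V → ℝ}
    (hlim : ∀ x, Tendsto (fun n => u n x) U (𝓝 (u' x))) (x : V) :
    Tendsto (fun n => negPart (u n) x) U (𝓝 (negPart u' x)) := (hlim x).min tendsto_const_nhds

/-- Off D each term of the pairing with u⁺, including the negated nonlinear one, has a nonnegative
summand. Fatou therefore bounds the limiting pairing above by 0, although equality may be lost. -/
theorem pairing_posPart_nonpos_of_tendsto {U : Filter ℕ} [U.NeBot] (ha : 0 ≤ a) (hb : 0 ≤ b)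
    (hp : 4 < p) (D : Finset V) {u : ℕ → V → ℝ} {u' : V → ℝ} (hu : ∀ n, u n ∈ weightedL2 ρ hρ)
    (hu' : u' ∈ weightedL2 ρ hρ) (h1 : ∀ n, ∀ x ∉ D, |u n x| ≤ 1)
    (hlim : ∀ x, Tendsto (fun n => u n x) U (𝓝 (u' x)))
    (h0 : ∀ n, pairing a b p ρ (u n) (posPart (u n)) = 0) :
    pairing a b p ρ u' (posPart u') ≤ 0 := by
  have hp2 : 2 < p := by linarith
  have hup := posPart_mem hu'
  have hX : ∀ u : V → ℝ, 0 ≤ gradInt u (posPart u) := fun u =>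
    tsum_nonneg (gradForm_posPart_nonneg u)
  have key := le_of_forall_pos_continuous (β := 0) (G := fun δ =>
    a * (gradInt u' (posPart u') - δ) + (mass ρ u' (posPart u') - δ) +
      b * max (gradInt u' u' - δ) 0 * max (gradInt u' (posPart u') - δ) 0 +
      (∑' x, -(nonlin p (u' x) * posPart u' x) - δ)) (by fun_prop) ?_
  · simp only [sub_zero, max_eq_left (gradInt_self_nonneg u'), max_eq_left (hX u'), tsum_neg] at key
    rw [pairing]
    linarith
  intro δ hδ
  have e0 := eventually_sub_lt_tsum (U := U) D (fun n x _ => gradForm_posPart_nonneg (u n) x)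
    (fun n => summable_gradForm (hu n) (posPart_mem (hu n)))
    (tendsto_gradForm hlim (tendsto_posPart hlim)) (summable_gradForm hu' hup) hδ
  have e1 := eventually_sub_lt_tsum (U := U) D (fun n x _ => gradForm_self_nonneg (u n) x)
    (fun n => summable_gradForm (hu n) (hu n)) (tendsto_gradForm hlim hlim)
    (summable_gradForm hu' hu') hδ
  have e2 := eventually_sub_lt_tsum (U := U) (g := fun n x => ρ x * u n x * posPart (u n) x) D
    (fun n x _ => by
      rw [mul_assoc]
      exact mul_nonneg (zero_le_one.trans (hρ x)) (mul_posPart_nonneg (u n) x))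
    (fun n => summable_weight_mul (hu n) (posPart_mem (hu n)))
    (fun x => (tendsto_const_nhds.mul (hlim x)).mul (tendsto_posPart hlim x))
    (summable_weight_mul hu' hup) hδ
  have e3 := eventually_sub_lt_tsum (U := U) (g := fun n x => -(nonlin p (u n x) * posPart (u n) x))
    D (fun n x hx => neg_nonneg.2 (nonlin_mul_posPart_nonpos hp2 (le_of_abs_le (h1 n x hx))))
    (fun n => (summable_nonlin_mul hp2 (hu n) (posPart_mem (hu n))).neg)
    (fun x => (((continuous_nonlin hp).tendsto _ |>.comp (hlim x)).mul
      (tendsto_posPart hlim x)).neg)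
    (summable_nonlin_mul hp2 hu' hup).neg hδ
  obtain ⟨n, k0, k1, k2, k3⟩ := (e0.and (e1.and (e2.and e3))).exists
  change gradInt u' (posPart u') - δ < gradInt (u n) (posPart (u n)) at k0
  change gradInt u' u' - δ < gradInt (u n) (u n) at k1
  change mass ρ u' (posPart u') - δ < mass ρ (u n) (posPart (u n)) at k2
  have hm := mul_le_mul (mul_le_mul_of_nonneg_left (max_le k1.le (gradInt_self_nonneg _)) hb)
    (max_le k0.le (hX (u n))) (le_max_right _ _) (mul_nonneg hb (gradInt_self_nonneg _))
  have k4 := mul_le_mul_of_nonneg_left k0.le ha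
  rw [tsum_neg (f := fun x => nonlin p (u n x) * posPart (u n) x)] at k3
  have k5 := h0 n
  rw [pairing] at k5
  linarith

/-- A Nehari condition forces values above `1`. -/
theorem exists_one_le_of_pairing_posPart (ha : 0 ≤ a) (hb : 0 ≤ b) (hp : 2 < p) (D : Finset V)
    {u : V → ℝ} (hu : u ∈ weightedL2 ρ hρ) (h1 : ∀ x ∉ D, |u x| ≤ 1) (hpos : posPart u ≠ 0)
    (h0 : pairing a b p ρ u (posPart u) = 0) : ∃ x ∈ D, 1 ≤ u x := by
  by_contra! hD
  have hle : ∀ x, u x ≤ 1 := fun x => by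
    by_cases hx : x ∈ D
    · exact (hD x hx).le
    · exact le_of_abs_le (h1 x hx)
  -- With u ≤ 1 everywhere the nonlinear term cannot balance the positive mass of u⁺.
  have hS : ∑' x, nonlin p (u x) * posPart u x ≤ 0 :=
    tsum_nonpos fun x => nonlin_mul_posPart_nonpos hp (hle x)
  have hX : 0 ≤ gradInt u (posPart u) := tsum_nonneg (gradForm_posPart_nonneg u)
  have hP : 0 < mass ρ u (posPart u) := by
    have h := mass_add_left (posPart_mem hu) (negPart_mem hu) (posPart_mem hu)
    rw [posPart_add_negPart, mass_comm ρ (negPart u),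
      mass_eq_zero_of_disjoint (posPart_mul_negPart u), add_zero] at h
    rw [h]
    exact mass_self_pos (posPart_mem hu) hpos
  have k1 := mul_nonneg ha hX
  have k2 := mul_nonneg (mul_nonneg hb (gradInt_self_nonneg u)) hX
  rw [pairing] at h0
  linarith

/-- Since D is finite, values at least 1 cannot escape: a limit below 1 on D would force all values
on D below 1 for some n. -/
theorem posPart_ne_zero_of_tendsto {U : Filter ℕ} [U.NeBot] (D : Finset V) {u : ℕ → V → ℝ}
    {u' : V → ℝ} (hlim : ∀ x, Tendsto (fun n => u n x) U (𝓝 (u' x)))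
    (h : ∀ n, ∃ x ∈ D, 1 ≤ u n x) : posPart u' ≠ 0 := by
  intro h0
  have hlt : ∀ x, u' x < 1 := fun x => by
    have := congrFun h0 x
    simp only [posPart, Pi.zero_apply, max_eq_right_iff] at this
    linarith
  have hev : ∀ᶠ n in U, ∀ x ∈ D, u n x < 1 :=
    (Filter.eventually_all_finset D).2 fun x _ => (tendsto_order.1 (hlim x)).2 1 (hlt x)
  obtain ⟨n, hn⟩ := hev.exists
  obtain ⟨x, hx, hx1⟩ := h n
  exact (hn x hx).not_ge hx1

/-- The energy attains its minimum on the sign-changing Nehari set as soon as the weight is large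
off a finite set. -/
theorem exists_minimizer (ha : 0 ≤ a) (hb : 0 ≤ b) (hp : 4 < p) (D : Finset V) {w₀ : V → ℝ}
    (hw₀ : w₀ ∈ nodalSet a b p ρ hρ)
    (hD : ∀ x ∉ D, energy a b p ρ w₀ + 1 ≤ (1 / 2 - 1 / p) * ρ x) :
    ∃ w ∈ nodalSet a b p ρ hρ, ∀ v ∈ nodalSet a b p ρ hρ, energy a b p ρ w ≤ energy a b p ρ v := by
  have hp2 : 2 < p := by linarith
  have hθ := half_sub_inv_pos hp
  have hmass : ∀ v ∈ nodalSet a b p ρ hρ, (1 / 2 - 1 / p) * mass ρ v v ≤ energy a b p ρ v :=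
    fun v hv => mass_le_energy ha hb hp hv.1 (pairing_self_of_mem_nodalSet hp2 hv)
  have h0 : ∀ v ∈ nodalSet a b p ρ hρ, 0 ≤ energy a b p ρ v := fun v hv =>
    (mul_nonneg hθ.le (mass_self_nonneg hρ v)).trans (hmass v hv)
  set A := energy a b p ρ '' nodalSet a b p ρ hρ with hA
  have hbdd : BddBelow A := ⟨0, by rintro _ ⟨v, hv, rfl⟩; exact h0 v hv⟩
  have hmle : ∀ v ∈ nodalSet a b p ρ hρ, sInf A ≤ energy a b p ρ v := fun v hv =>
    csInf_le hbdd ⟨v, hv, rfl⟩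
  have hseq : ∀ n : ℕ, ∃ v ∈ nodalSet a b p ρ hρ, energy a b p ρ v < sInf A + 1 / ((n : ℝ) + 1) := by
    intro n
    obtain ⟨_, ⟨v, hv, rfl⟩, hlt⟩ := exists_lt_of_csInf_lt (s := A) ⟨_, w₀, hw₀, rfl⟩
      (lt_add_of_pos_right (sInf A) (show 0 < 1 / ((n : ℝ) + 1) by positivity))
    exact ⟨v, hv, hlt⟩
  choose u hu hum using hseq
  have hu1 : ∀ n, (1 / 2 - 1 / p) * mass ρ (u n) (u n) ≤ energy a b p ρ w₀ + 1 := fun n => by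
    have h1 : 1 / ((n : ℝ) + 1) ≤ 1 := by
      rw [div_le_one (by positivity)]
      linarith [Nat.cast_nonneg (α := ℝ) n]
    linarith [hmass _ (hu n), hum n, hmle _ hw₀]
  -- A uniform mass bound for the minimizing sequence. By `hD`, ρ ≥ M₀ off D, hence |u n x| ≤ 1
  -- there.
  set M₀ := (energy a b p ρ w₀ + 1) / (1 / 2 - 1 / p) with hM₀
  have hM₀pos : 0 < M₀ := div_pos (by linarith [h0 _ hw₀]) hθ
  have huM : ∀ n, mass ρ (u n) (u n) ≤ M₀ := fun n => (le_div_iff₀' hθ).2 (hu1 n)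
  have hone : ∀ n, ∀ x ∉ D, |u n x| ≤ 1 := by
    intro n x hx
    have hρx : M₀ ≤ ρ x := (div_le_iff₀' hθ).2 (hD x hx)
    rw [← sq_le_one_iff_abs_le_one]
    have h1 := (weight_mul_sq_le_mass (hu n).1 x).trans (huM n)
    have h2 := mul_le_mul_of_nonneg_right hρx (sq_nonneg (u n x))
    by_contra! hlt
    nlinarith
  -- Along a nonprincipal ultrafilter every bounded sequence of values converges, so no diagonal
  -- subsequence is needed.
  let U : Ultrafilter ℕ := Filter.hyperfilter ℕ
  have hUle : (U : Filter ℕ) ≤ atTop := Nat.hyperfilter_le_atTop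
  have hex : ∀ x, ∃ l, Tendsto (fun n => u n x) U (𝓝 l) := by
    intro x
    have hmem : ∀ n, u n x ∈ Set.Icc (-√M₀) √M₀ := fun n =>
      abs_le.1 (Real.abs_le_sqrt ((sq_le_mass (hu n).1 x).trans (huM n)))
    obtain ⟨l, -, hl⟩ := (isCompact_Icc (a := -√M₀) (b := √M₀)).ultrafilter_le_nhds
      (U.map fun n => u n x) (le_principal_iff.2 (Filter.mem_map.2 (Filter.univ_mem' hmem)))
    exact ⟨l, hl⟩
  choose u' hlim using hex
  have hu' : u' ∈ weightedL2 ρ hρ := by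
    refine summable_of_sum_le (c := M₀)
      (fun x => mul_nonneg (zero_le_one.trans (hρ x)) (sq_nonneg _)) fun F => ?_
    refine le_of_tendsto (f := fun n => ∑ x ∈ F, ρ x * u n x ^ 2) (x := (U : Filter ℕ))
      (tendsto_finsetSum F fun x _ => tendsto_const_nhds.mul ((hlim x).pow 2))
      (Eventually.of_forall fun n => ?_)
    refine (Summable.sum_le_tsum F (fun x _ => mul_nonneg (zero_le_one.trans (hρ x))
      (sq_nonneg _)) (hu n).1).trans (le_trans (le_of_eq ?_) (huM n))
    exact tsum_congr fun x => by ring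
  have hun : ∀ n, -u n ∈ nodalSet a b p ρ hρ := fun n => neg_mem_nodalSet (hu n)
  have honen : ∀ n, ∀ x ∉ D, |(-u n) x| ≤ 1 := fun n x hx => by
    rw [Pi.neg_apply, abs_neg]
    exact hone n x hx
  have hlimn : ∀ x, Tendsto (fun n => (-u n) x) U (𝓝 ((-u') x)) := fun x => (hlim x).neg
  have hpos : posPart u' ≠ 0 := posPart_ne_zero_of_tendsto D hlim fun n =>
    exists_one_le_of_pairing_posPart ha hb hp2 D (hu n).1 (hone n) (hu n).2.1 (hu n).2.2.2.1
  have hneg : negPart u' ≠ 0 := by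
    have : posPart (-u') ≠ 0 := posPart_ne_zero_of_tendsto D hlimn fun n =>
      exists_one_le_of_pairing_posPart ha hb hp2 D (hun n).1 (honen n) (hun n).2.1 (hun n).2.2.2.1
    rw [posPart_neg] at this
    exact neg_ne_zero.1 this
  have hle1 : pairing a b p ρ u' (posPart u') ≤ 0 :=
    pairing_posPart_nonpos_of_tendsto ha hb hp D (fun n => (hu n).1) hu' hone hlim
      fun n => (hu n).2.2.2.1
  have hle2 : pairing a b p ρ u' (negPart u') ≤ 0 := by
    have := pairing_posPart_nonpos_of_tendsto ha hb hp D (fun n => (hun n).1)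
      (Submodule.neg_mem _ hu') honen hlimn fun n => (hun n).2.2.2.1
    rwa [posPart_neg, pairing_neg] at this
  obtain ⟨s, t, hs, ht, hs1, ht1, hw⟩ :=
    exists_le_one_mem_nodalSet ha hb hp hu' hpos hneg hle1 hle2
  refine ⟨_, hw, fun v hv => le_trans ?_ (hmle v hv)⟩
  refine le_of_forall_pos_le_add fun ε hε => ?_
  -- Semicontinuity is applied to the rescaled sequence: s, t ≤ 1 keeps it bounded by 1 off D, and
  -- each u n maximizes the energy on its own cone.
  refine energy_le_of_tendsto (U := (U : Filter ℕ)) ha hb hp D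
    (w := fun n => s • posPart (u n) + t • negPart (u n))
    (fun n => Submodule.add_mem _ (Submodule.smul_mem _ _ (posPart_mem (hu n).1))
      (Submodule.smul_mem _ _ (negPart_mem (hu n).1))) hw.1 ?_ ?_ ?_
  · intro n x hx
    have h1 := abs_le.1 (hone n x hx)
    simp only [Pi.add_apply, Pi.smul_apply, smul_eq_mul]
    rcases le_total (u n x) 0 with h | h
    · rw [posPart, negPart, max_eq_right h, min_eq_left h, abs_le]
      constructor <;> nlinarith
    · rw [posPart, negPart, max_eq_left h, min_eq_right h, abs_le]
      constructor <;> nlinarith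
  · exact fun x => ((tendsto_posPart hlim x).const_mul s).add ((tendsto_negPart hlim x).const_mul t)
  · have hev : ∀ᶠ n : ℕ in atTop, 1 / ((n : ℝ) + 1) < ε :=
      (tendsto_order.1 tendsto_one_div_add_atTop_nhds_zero_nat).2 ε hε
    filter_upwards [hUle hev] with n hn
    exact (energy_parts_le ha hb hp (hu n) hs.le ht.le).trans (by linarith [hum n])

end

/-! ### Minimizers solve the equation. -/

noncomputable section

open Filter Topology

theorem hasDerivAt_of_sq_bound {F : ℝ → ℝ} {e d C r : ℝ} (hr : 0 < r)
    (h : ∀ t, |t| ≤ r → |F (e + t) - F e - t * d| ≤ C * t ^ 2) : HasDerivAt F d e := by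
  rw [hasDerivAt_iff_isLittleO_nhds_zero]
  refine Asymptotics.IsBigO.trans_isLittleO (g := fun t : ℝ => t ^ 2) ?_ ?_
  · refine Asymptotics.IsBigO.of_bound C ?_
    filter_upwards [Metric.closedBall_mem_nhds (0 : ℝ) hr] with t ht
    rw [mem_closedBall_zero_iff, Real.norm_eq_abs] at ht
    rw [Real.norm_eq_abs, Real.norm_eq_abs, abs_of_nonneg (sq_nonneg t), smul_eq_mul]
    exact h t ht
  · simpa using Asymptotics.isLittleO_pow_pow (𝕜 := ℝ) (m := 1) (n := 2) (by norm_num)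

variable {a b p : ℝ} {ρ : V → ℝ} {hρ : ∀ x, 1 ≤ ρ x}

theorem hasDerivAt_energy_line (ha : 0 ≤ a) (hb : 0 ≤ b) (hp : 4 < p) {v φ : V → ℝ}
    (hv : v ∈ weightedL2 ρ hρ) (hφ : φ ∈ weightedL2 ρ hρ) (e : ℝ) :
    HasDerivAt (fun e => energy a b p ρ (v + e • φ)) (pairing a b p ρ (v + e • φ) φ) e := by
  have hu := Submodule.add_mem _ hv (Submodule.smul_mem _ e hφ)
  have hE := gradInt_self_nonneg φ
  have hP := mass_self_nonneg hρ φ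
  obtain ⟨C, -, H⟩ := exists_energy_taylor ha hb hp hu (K := gradInt φ φ) hE
  refine hasDerivAt_of_sq_bound (C := C * (gradInt φ φ + mass ρ φ φ))
    (r := min 1 (1 / (mass ρ φ φ + 1))) (by positivity) fun t ht => ?_
  have ht1 : t ^ 2 ≤ 1 := (sq_le_one_iff_abs_le_one t).2 (ht.trans (min_le_left _ _))
  have ht2 : t ^ 2 * (mass ρ φ φ + 1) ≤ 1 := by
    have h := ht.trans (min_le_right _ _)
    rw [le_div_iff₀ (by positivity)] at h
    have h1 : |t| ≤ 1 := ht.trans (min_le_left _ _)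
    rw [← sq_abs]
    nlinarith [abs_nonneg t, mul_nonneg (abs_nonneg t) hP]
  have key := H (t • φ) (Submodule.smul_mem _ t hφ) ?_ ?_
  · rw [pairing_smul] at key
    simp only [gradInt_smul_left, gradInt_smul_right, mass_smul_left, mass_smul_right] at key
    rw [add_assoc, ← add_smul] at key
    refine key.trans (le_of_eq ?_)
    ring
  · simp only [gradInt_smul_left, gradInt_smul_right]
    nlinarith
  · simp only [mass_smul_left, mass_smul_right]
    nlinarith [sq_nonneg t]

/-- The test function lives at one vertex, so the pairing is a polynomial in the three parameters
plus one value of `nonlin`. -/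
theorem continuous_pairing_comb (hp : 4 < p) {f g : V → ℝ} (hf : f ∈ weightedL2 ρ hρ)
    (hg : g ∈ weightedL2 ρ hρ) (x : V) (τ : ℝ) :
    Continuous fun z : ℝ × ℝ × ℝ => pairing a b p ρ
      (z.1 • f + z.2.1 • g + z.2.2 • Pi.single x τ) (Pi.single x τ) := by
  have hδ : (Pi.single x τ : V → ℝ) ∈ weightedL2 ρ hρ := single_mem x τ
  have e : ∀ z : ℝ × ℝ × ℝ, pairing a b p ρ
      (z.1 • f + z.2.1 • g + z.2.2 • Pi.single x τ) (Pi.single x τ) =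
      ((a + b * (z.1 ^ 2 * gradInt f f + 2 * (z.1 * z.2.1) * gradInt f g +
          z.2.1 ^ 2 * gradInt g g + 2 * z.2.2 * (z.1 * gradInt f (Pi.single x τ) +
          z.2.1 * gradInt g (Pi.single x τ)) +
          z.2.2 ^ 2 * gradInt (Pi.single x τ) (Pi.single x τ))) *
        (z.1 * gradInt f (Pi.single x τ) + z.2.1 * gradInt g (Pi.single x τ) +
          z.2.2 * gradInt (Pi.single x τ) (Pi.single x τ)) +
      (z.1 * mass ρ f (Pi.single x τ) + z.2.1 * mass ρ g (Pi.single x τ) +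
          z.2.2 * mass ρ (Pi.single x τ) (Pi.single x τ))) -
      nonlin p (z.1 * f x + z.2.1 * g x + z.2.2 * τ) * τ := by
    rintro ⟨s, t, e⟩
    have hsf := Submodule.smul_mem _ s hf
    have htg := Submodule.smul_mem _ t hg
    have hed := Submodule.smul_mem _ e hδ
    have hfg := Submodule.add_mem _ hsf htg
    have h1 := gradInt_comb hfg hδ 1 e
    rw [one_smul, gradInt_comb hf hg, gradInt_add_left hsf htg hδ] at h1
    have h2 : ∑' y, nonlin p ((s • f + t • g + e • (Pi.single x τ : V → ℝ)) y) *
        (Pi.single x τ : V → ℝ) y = nonlin p (s * f x + t * g x + e * τ) * τ := by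
      rw [tsum_eq_single x fun y hy => by simp [hy]]
      simp
    rw [pairing, h1, h2, gradInt_add_left hfg hed hδ, gradInt_add_left hsf htg hδ,
      mass_add_left hfg hed hδ, mass_add_left hsf htg hδ]
    simp only [gradInt_smul_left, mass_smul_left]
    ring
  rw [funext e]
  have hn := continuous_nonlin hp
  fun_prop

/-- One-sided stationarity of a minimizer under perturbations at a vertex that keep the positive
and negative parts separate. -/
theorem pairing_single_nonneg (ha : 0 ≤ a) (hb : 0 ≤ b) (hp : 4 < p) {w : V → ℝ}
    (hw : w ∈ nodalSet a b p ρ hρ)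
    (hmin : ∀ v ∈ nodalSet a b p ρ hρ, energy a b p ρ w ≤ energy a b p ρ v) {x : V} {τ : ℝ}
    (hx : 0 ≤ w x) (hτ : 0 < w x ∨ 0 ≤ τ) : 0 ≤ pairing a b p ρ w (Pi.single x τ) := by
  have hp2 : 2 < p := by linarith
  have hp3 : 3 < p := by linarith
  by_contra! hlt
  set f := posPart w with hf
  set g := negPart w with hg
  have hfg : SignedPair ρ hρ f g := signedPair_parts hw.1 hw.2.1 hw.2.2.1
  have hfgw : f + g = w := posPart_add_negPart w
  have hδ : (Pi.single x τ : V → ℝ) ∈ weightedL2 ρ hρ := single_mem x τ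
  set δ : V → ℝ := Pi.single x τ with hδdef
  have hfx : f x = w x := max_eq_left hx
  have hgx : g x = 0 := min_eq_right hx
  have hcont := continuous_pairing_comb (a := a) (b := b) hp hfg.mem_left hfg.mem_right x τ
  obtain ⟨r₀, hr₀, hneg⟩ := Metric.eventually_nhds_iff.1
    (hcont.continuousAt.eventually_lt (x₀ := ((1 : ℝ), (1 : ℝ), (0 : ℝ))) continuousAt_const
      (by simpa [hfgw] using hlt))
  obtain ⟨r, hr, hr1, hrr₀⟩ : ∃ r, 0 < r ∧ r < 1 ∧ r < r₀ :=
    ⟨min (1 / 2) (r₀ / 2), by positivity, by linarith [min_le_left (1 / 2 : ℝ) (r₀ / 2)],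
      by linarith [min_le_right (1 / 2 : ℝ) (r₀ / 2)]⟩
  have hneg' : ∀ s ∈ Set.Icc (1 - r) (1 + r), ∀ t ∈ Set.Icc (1 - r) (1 + r), ∀ e ∈ Set.Icc 0 r,
      pairing a b p ρ (s • f + t • g + e • δ) δ < 0 := by
    intro s hs t ht e he
    refine hneg (y := (s, t, e)) ?_
    rw [Prod.dist_eq, Prod.dist_eq, max_lt_iff, max_lt_iff]
    simp only [Real.dist_eq]
    refine ⟨lt_of_le_of_lt (abs_le.2 ⟨?_, ?_⟩) hrr₀, lt_of_le_of_lt (abs_le.2 ⟨?_, ?_⟩) hrr₀,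
      lt_of_le_of_lt (abs_le.2 ⟨?_, ?_⟩) hrr₀⟩ <;> linarith [hs.1, hs.2, ht.1, ht.2, he.1, he.2]
  -- The derivative in the direction δ stays negative on the box, so the mean value theorem gives a
  -- decrease.
  have hdecr : ∀ s ∈ Set.Icc (1 - r) (1 + r), ∀ t ∈ Set.Icc (1 - r) (1 + r), ∀ e ∈ Set.Ioc 0 r,
      energy a b p ρ (s • f + t • g + e • δ) < energy a b p ρ (s • f + t • g) := by
    intro s hs t ht e he
    have hmem : s • f + t • g ∈ weightedL2 ρ hρ := Submodule.add_mem _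
      (Submodule.smul_mem _ s hfg.mem_left) (Submodule.smul_mem _ t hfg.mem_right)
    have hd := hasDerivAt_energy_line ha hb hp hmem hδ
    obtain ⟨c, hc, hceq⟩ := exists_hasDerivAt_eq_slope
      (fun e => energy a b p ρ (s • f + t • g + e • δ)) _ he.1
      (fun z _ => (hd z).continuousAt.continuousWithinAt) fun z _ => hd z
    have hcneg := hneg' s hs t ht c ⟨hc.1.le, hc.2.le.trans he.2⟩
    rw [hceq, zero_smul, add_zero, sub_zero, div_neg_iff] at hcneg
    rcases hcneg with h | h
    · linarith [he.1]
    · linarith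
  obtain ⟨hs1, hs2⟩ := slopes_of_mem_nodalSet hp2 hw
  have hval1 : energy a b p ρ w = (coneData p ρ f g).val a b p 1 1 := energy_eq_val_one hp2 hw.1
  have hadm := hfg.admissible hp2
  set box : Set (ℝ × ℝ) := Set.Icc (1 - r) (1 + r) ×ˢ Set.Icc (1 - r) (1 + r) with hbox
  have hboxc : IsCompact box := isCompact_Icc.prod isCompact_Icc
  set edge : Set (ℝ × ℝ) := box ∩ {z | |z.1 - 1| = r ∨ |z.2 - 1| = r} with hedge
  have hedgec : IsCompact edge := hboxc.inter_right
    ((isClosed_eq (by fun_prop) continuous_const).union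
      (isClosed_eq (by fun_prop) continuous_const))
  obtain ⟨⟨s₀, t₀⟩, hz₀, hz₀max⟩ := hedgec.exists_isMaxOn
    ⟨(1 + r, 1), ⟨⟨by constructor <;> linarith, by constructor <;> linarith⟩,
      Or.inl (by simp [abs_of_pos hr])⟩⟩
    (FiberData.continuous_val (a := a) (b := b) hp3 (coneData p ρ f g)).continuousOn
  -- The strict maximum at (1, 1) leaves a gap to the boundary of the box; a small perturbation
  -- preserves it.
  have hm₁ : (coneData p ρ f g).val a b p s₀ t₀ < energy a b p ρ w := by
    rw [hval1]
    obtain ⟨⟨h1, h2⟩, h3⟩ := hz₀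
    refine FiberData.val_lt_of_slope_eq_zero ha hb hp hadm hs1 hs2 (by linarith [h1.1])
      (by linarith [h2.1]) ?_
    by_contra! hcon
    rcases h3 with h3 | h3
    · simp [hcon.1] at h3
      linarith
    · simp [hcon.2] at h3
      linarith
  have hev1 : ∀ᶠ e in 𝓝[>] (0 : ℝ), (coneData p ρ f g).val a b p s₀ t₀ <
      energy a b p ρ (w + e • δ) := by
    refine nhdsWithin_le_nhds ?_
    refine continuousAt_const.eventually_lt (hasDerivAt_energy_line ha hb hp hw.1 hδ 0).continuousAt
      (by simpa using hm₁)
  -- Scaling by s ≤ 1 + r < 2 turns ε into sε, which must remain at most r.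
  have hev2 : ∀ᶠ e in 𝓝[>] (0 : ℝ), e < r / 2 :=
    nhdsWithin_le_nhds (gt_mem_nhds (by positivity))
  -- The perturbed positive part must stay nonnegative and nonzero. If w x = 0 only directions τ ≥ 0
  -- are allowed.
  have hev3 : ∀ᶠ e in 𝓝[>] (0 : ℝ), 0 ≤ w x + e * τ ∧ (0 < w x → 0 < w x + e * τ) := by
    rcases hx.eq_or_lt with h0 | h0
    · filter_upwards [self_mem_nhdsWithin] with e he
      have hτ0 : 0 ≤ τ := hτ.resolve_left (by rw [← h0]; exact lt_irrefl _)
      rw [← h0]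
      exact ⟨by simpa using mul_nonneg (le_of_lt he) hτ0, fun h => absurd h (lt_irrefl _)⟩
    · have : ∀ᶠ e in 𝓝 (0 : ℝ), 0 < w x + e * τ :=
        continuousAt_const.eventually_lt (by fun_prop) (by simpa using h0)
      filter_upwards [nhdsWithin_le_nhds this] with e he
      exact ⟨he.le, fun _ => he⟩
  obtain ⟨ε, ⟨hε1, hε2, hε3, hε4⟩, hε⟩ :=
    ((hev1.and (hev2.and hev3)).and self_mem_nhdsWithin).exists
  replace hε : 0 < ε := hε
  have hother : ∀ y, y ≠ x → (f + ε • δ) y = f y := fun y hy => by simp [hδdef, hy]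
  have hatx : (f + ε • δ) x = w x + ε * τ := by simp [hδdef, hfx]
  have hfg' : SignedPair ρ hρ (f + ε • δ) g := by
    refine ⟨Submodule.add_mem _ hfg.mem_left (Submodule.smul_mem _ ε hδ), hfg.mem_right, ?_,
      hfg.nonpos, ?_, ?_, hfg.right_ne⟩
    · intro y
      rcases eq_or_ne y x with rfl | hy
      · rwa [hatx]
      · rw [hother y hy]
        exact hfg.nonneg y
    · intro y
      rcases eq_or_ne y x with rfl | hy
      · rw [hgx, mul_zero]
      · rw [hother y hy]
        exact hfg.disjoint y
    · obtain ⟨y, hy⟩ := Function.ne_iff.1 hfg.left_ne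
      refine Function.ne_iff.2 ⟨y, ?_⟩
      rcases eq_or_ne y x with rfl | hyx
      · rw [hatx]
        exact (hε4 (hx.lt_of_ne fun h => hy (by rw [hfx, ← h]; rfl))).ne'
      · rwa [hother y hyx]
  have hcomb : ∀ s t : ℝ, s • (f + ε • δ) + t • g = s • f + t • g + (s * ε) • δ := fun s t => by
    rw [smul_add, smul_smul]
    abel
  have hval' : ∀ s ∈ Set.Icc (1 - r) (1 + r), ∀ t ∈ Set.Icc (1 - r) (1 + r),
      (coneData p ρ (f + ε • δ) g).val a b p s t < (coneData p ρ f g).val a b p s t := by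
    intro s hs t ht
    have hs0 : 0 < s := by linarith [hs.1]
    have ht0 : 0 < t := by linarith [ht.1]
    rw [← energy_comb hp2 hfg'.mem_left hfg'.mem_right hfg'.disjoint hs0.le ht0.le,
      ← energy_comb hp2 hfg.mem_left hfg.mem_right hfg.disjoint hs0.le ht0.le, hcomb]
    exact hdecr s hs t ht _ ⟨by positivity, by nlinarith [hs.2]⟩
  obtain ⟨⟨s, t⟩, hst, hmax⟩ := hboxc.exists_isMaxOn
    ⟨(1, 1), ⟨by constructor <;> linarith, by constructor <;> linarith⟩⟩
    (FiberData.continuous_val (a := a) (b := b) hp3 (coneData p ρ (f + ε • δ) g)).continuousOn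
  have hmax' : ∀ s' ∈ Set.Icc (1 - r) (1 + r), ∀ t' ∈ Set.Icc (1 - r) (1 + r),
      (coneData p ρ (f + ε • δ) g).val a b p s' t' ≤
        (coneData p ρ (f + ε • δ) g).val a b p s t :=
    fun s' hs' t' ht' => isMaxOn_iff.1 hmax (s', t') (Set.mk_mem_prod hs' ht')
  have hs : s ∈ Set.Icc (1 - r) (1 + r) := hst.1
  have ht : t ∈ Set.Icc (1 - r) (1 + r) := hst.2
  have hone : (1 : ℝ) ∈ Set.Icc (1 - r) (1 + r) := by constructor <;> linarith
  -- On the edge the perturbed value is below the unperturbed edge maximum, hence below the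
  -- perturbed value at (1, 1).
  have hnot : ¬(|s - 1| = r ∨ |t - 1| = r) := by
    intro hedge'
    have h1 : (coneData p ρ f g).val a b p s t ≤ (coneData p ρ f g).val a b p s₀ t₀ :=
      isMaxOn_iff.1 hz₀max (s, t) ⟨hst, hedge'⟩
    have h2 := hmax' 1 hone 1 hone
    rw [← energy_comb hp2 hfg'.mem_left hfg'.mem_right hfg'.disjoint zero_le_one zero_le_one,
      hcomb, one_smul, one_smul, hfgw, one_mul] at h2
    linarith [hval' s hs t ht]
  push Not at hnot
  have hsI : s ∈ Set.Ioo (1 - r) (1 + r) :=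
    ⟨hs.1.lt_of_ne fun h => hnot.1 (by rw [← h]; simp [abs_of_pos hr]),
      hs.2.lt_of_ne fun h => hnot.1 (by rw [h]; simp [abs_of_pos hr])⟩
  have htI : t ∈ Set.Ioo (1 - r) (1 + r) :=
    ⟨ht.1.lt_of_ne fun h => hnot.2 (by rw [← h]; simp [abs_of_pos hr]),
      ht.2.lt_of_ne fun h => hnot.2 (by rw [h]; simp [abs_of_pos hr])⟩
  have hs0 : 0 < s := by linarith [hs.1]
  have ht0 : 0 < t := by linarith [ht.1]
  obtain ⟨k1, k2⟩ := FiberData.slope_eq_zero_of_isMax (a := a) (b := b) (p := p) hp3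
    (coneData p ρ (f + ε • δ) g) (by linarith) (by linarith) hsI htI hmax'
  -- The interior maximum is a nodal point. Its energy is below the unperturbed value at (s, t),
  -- which is at most the energy of w, contradicting minimality.
  have hle := hmin _ (hfg'.comb_mem_nodalSet hp2 hs0 ht0 k1 k2)
  rw [energy_comb hp2 hfg'.mem_left hfg'.mem_right hfg'.disjoint hs0.le ht0.le, hval1] at hle
  have := FiberData.val_le_of_slope_eq_zero ha hb hp hadm hs1 hs2 hs0.le ht0.le
  linarith [hval' s hs t ht]

/-- A minimizer on the sign-changing Nehari set solves the equation. -/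
theorem residual_eq_zero (ha : 0 ≤ a) (hb : 0 ≤ b) (hp : 4 < p) {w : V → ℝ}
    (hw : w ∈ nodalSet a b p ρ hρ)
    (hmin : ∀ v ∈ nodalSet a b p ρ hρ, energy a b p ρ w ≤ energy a b p ρ v) (x : V) :
    residual a b p ρ w x = 0 := by
  have hp2 : 2 < p := by linarith
  have hmin' : ∀ v ∈ nodalSet a b p ρ hρ, energy a b p ρ (-w) ≤ energy a b p ρ v :=
    fun v hv => (energy_neg w).le.trans (hmin v hv)
  have h1 : ∀ τ, 0 ≤ w x → (0 < w x ∨ 0 ≤ τ) → 0 ≤ residual a b p ρ w x * τ := fun τ h h' => by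
    rw [← pairing_single hp2 hw.1]
    exact pairing_single_nonneg ha hb hp hw hmin h h'
  have h2 : ∀ τ, w x ≤ 0 → (w x < 0 ∨ 0 ≤ τ) → 0 ≤ -(residual a b p ρ w x * τ) := by
    intro τ h h'
    have key := pairing_single_nonneg ha hb hp (neg_mem_nodalSet hw) hmin' (x := x) (τ := τ)
      (by simpa using h) (by simpa using h')
    have e : (Pi.single x τ : V → ℝ) = -Pi.single x (-τ) := by rw [← Pi.single_neg, neg_neg]
    rw [e, pairing_neg, pairing_single hp2 hw.1] at key
    linarith
  -- Where w x ≠ 0 both directions ±1 are admissible. Where w x = 0 the two opposite inequalities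
  -- come from the minimizers w and -w.
  rcases lt_trichotomy (w x) 0 with h | h | h
  · linarith [h2 1 h.le (Or.inl h), h2 (-1) h.le (Or.inl h)]
  · linarith [h1 1 h.ge (Or.inr zero_le_one), h2 1 h.le (Or.inr zero_le_one)]
  · linarith [h1 1 h.le (Or.inl h), h1 (-1) h.le (Or.inl h)]

theorem pairing_eq_zero_of_minimizer (ha : 0 ≤ a) (hb : 0 ≤ b) (hp : 4 < p) {w φ : V → ℝ}
    (hw : w ∈ nodalSet a b p ρ hρ)
    (hmin : ∀ v ∈ nodalSet a b p ρ hρ, energy a b p ρ w ≤ energy a b p ρ v)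
    (hφ : φ ∈ weightedL2 ρ hρ) : pairing a b p ρ w φ = 0 := by
  have h := hasSum_pairing (a := a) (b := b) (p := p) (by linarith) hw.1 hφ
  simp only [residual_eq_zero ha hb hp hw hmin, zero_mul] at h
  exact h.unique hasSum_zero

end

/-! ### A competitor in the well, uniform in λ, and the return to the original definitions. -/

noncomputable section

variable {a b p : ℝ} {h : V → ℝ}

theorem one_le_weight (hh : ∀ x, 0 ≤ h x) {lam : ℝ} (hlam : 0 ≤ lam) (x : V) :
    1 ≤ weight h lam x := by
  rw [weight]
  linarith [mul_nonneg hlam (hh x)]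

theorem mass_weight_of_support {u : V → ℝ} (hu : ∀ x, h x ≠ 0 → u x = 0) (lam lam' : ℝ)
    (φ : V → ℝ) : mass (weight h lam) u φ = mass (weight h lam') u φ := by
  refine tsum_congr fun x => ?_
  by_cases hx : h x = 0
  · simp [weight, hx]
  · simp [hu x hx]

/-- A sign-changing Nehari point supported in the well, for all parameters at once. -/
theorem exists_nodal_in_well (ha : 0 ≤ a) (hb : 0 ≤ b) (hp : 4 < p) (hh : ∀ x, 0 ≤ h x)
    (hwell : (well h).Nontrivial) :
    ∃ (w : V → ℝ) (E : ℝ), 0 ≤ E ∧ ∀ (lam : ℝ) (hlam : 0 ≤ lam),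
      w ∈ nodalSet a b p (weight h lam) (one_le_weight hh hlam) ∧
        energy a b p (weight h lam) w = E := by
  obtain ⟨x, hx, y, hy, hxy⟩ := hwell
  have hpair : SignedPair (weight h 0) (one_le_weight hh le_rfl) (Pi.single x 1)
      (Pi.single y (-1)) := by
    refine ⟨single_mem x 1, single_mem y (-1), fun z => ?_, fun z => ?_, fun z => ?_, ?_, ?_⟩
    · rcases eq_or_ne z x with rfl | hz
      · simp
      · simp [hz]
    · rcases eq_or_ne z y with rfl | hz
      · simp
      · simp [hz]
    · rcases eq_or_ne z x with rfl | hz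
      · simp [hxy]
      · simp [hz]
    · exact Function.ne_iff.2 ⟨x, by simp⟩
    · exact Function.ne_iff.2 ⟨y, by simp⟩
  -- The scaling is found at λ = 0 and serves every λ, because the weight equals 1 on the well.
  obtain ⟨s, t, hs, ht, hw⟩ := hpair.exists_mem_nodalSet ha hb hp
  have hparts := (hpair.smul hs ht).parts
  set f : V → ℝ := s • Pi.single x 1 with hf
  set g : V → ℝ := t • Pi.single y (-1) with hg
  have hfs : ∀ z, h z ≠ 0 → f z = 0 := fun z hz => by
    have : z ≠ x := fun e => hz (e ▸ hx)
    simp [hf, this]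
  have hgs : ∀ z, h z ≠ 0 → g z = 0 := fun z hz => by
    have : z ≠ y := fun e => hz (e ▸ hy)
    simp [hg, this]
  have hws : ∀ z, h z ≠ 0 → (f + g) z = 0 := fun z hz => by simp [hfs z hz, hgs z hz]
  have hp2 : 2 < p := by linarith
  refine ⟨f + g, energy a b p (weight h 0) (f + g), ?_, fun lam hlam => ⟨?_, ?_⟩⟩
  · exact (mul_nonneg (half_sub_inv_pos hp).le
      (mass_self_nonneg (one_le_weight hh le_rfl) _)).trans
      (mass_le_energy ha hb hp hw.1 (pairing_self_of_mem_nodalSet hp2 hw))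
  · refine ⟨Submodule.add_mem _ (Submodule.smul_mem _ s (single_mem x 1))
      (Submodule.smul_mem _ t (single_mem y (-1))), hw.2.1, hw.2.2.1, ?_, ?_⟩
    · rw [← hw.2.2.2.1, pairing, pairing, mass_weight_of_support hws lam 0]
    · rw [← hw.2.2.2.2, pairing, pairing, mass_weight_of_support hws lam 0]
  · rw [energy, energy, mass_weight_of_support hws lam 0]

theorem signNehari_eq (hh : ∀ x, 0 ≤ h x) {lam : ℝ} (hlam : 0 ≤ lam) :
    signNehari a b p h lam = nodalSet a b p (weight h lam) (one_le_weight hh hlam) := by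
  ext u
  have key : u ∈ HSpace h lam ↔ u ∈ weightedL2 (weight h lam) (one_le_weight hh hlam) :=
    mem_HSpace_iff hh hlam
  constructor
  · rintro ⟨h0, h1, h2, h3, h4⟩
    rw [key] at h0
    rw [dJ_eq h0 (posPart_mem h0)] at h3
    rw [dJ_eq h0 (negPart_mem h0)] at h4
    exact ⟨h0, h1, h2, h3, h4⟩
  · rintro ⟨h0, h1, h2, h3, h4⟩
    rw [← dJ_eq h0 (posPart_mem h0)] at h3
    rw [← dJ_eq h0 (negPart_mem h0)] at h4
    exact ⟨key.2 h0, h1, h2, h3, h4⟩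

theorem mem_nehari_iff (hh : ∀ x, 0 ≤ h x) {lam : ℝ} (hlam : 0 ≤ lam) {u : V → ℝ} :
    u ∈ nehari a b p h lam ↔ u ∈ weightedL2 (weight h lam) (one_le_weight hh hlam) ∧ u ≠ 0 ∧
      pairing a b p (weight h lam) u u = 0 := by
  have key : u ∈ HSpace h lam ↔ u ∈ weightedL2 (weight h lam) (one_le_weight hh hlam) :=
    mem_HSpace_iff hh hlam
  constructor
  · rintro ⟨h0, h1, h2⟩
    rw [key] at h0
    exact ⟨h0, h1, by rwa [← dJ_eq h0 h0]⟩
  · rintro ⟨h0, h1, h2⟩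
    exact ⟨key.2 h0, h1, by rwa [dJ_eq h0 h0]⟩

/-- The parts v⁺ and v⁻ are themselves admissible test functions, so minimality over the Nehari set
implies least energy among solutions. -/
theorem IsSignChangingSolution.mem_signNehari (ha : 0 < a) (hb : 0 ≤ b) (hp : 4 < p)
    (hh : ∀ x, 0 ≤ h x) {lam : ℝ} (hlam : 0 ≤ lam) {v : V → ℝ}
    (hv : IsSignChangingSolution a b p h lam v) : v ∈ signNehari a b p h lam := by
  obtain ⟨⟨h0, hcrit⟩, h1, h2⟩ := hv
  have key : ∀ {u : V → ℝ}, u ∈ HSpace h lam ↔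
      u ∈ weightedL2 (weight h lam) (one_le_weight hh hlam) := mem_HSpace_iff hh hlam
  have hz := (isCriticalPoint_iff ha hb hp hh hlam (key.1 h0)).1 hcrit
  exact ⟨h0, h1, h2, hz _ (key.2 (posPart_mem (key.1 h0))), hz _ (key.2 (negPart_mem (key.1 h0)))⟩

end

end LogKirchhoff

theorem theorem1p1 (a b p : ℝ) (ha : 0 < a) (hb : 0 < b) (hp : 6 < p)
    (h : LogKirchhoff.V → ℝ)
    -- the potential and its well
    (h_nonneg : ∀ x, 0 ≤ h x)
    (h_connected : (LogKirchhoff.lattice.induce (LogKirchhoff.well h)).Connected)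
    (h_bounded : Bornology.IsBounded (LogKirchhoff.well h))
    (h_nontrivial : (LogKirchhoff.well h).Nontrivial)
    -- some sublevel set is finite
    (h_finite : ∃ M : ℝ, 0 < M ∧ {x | h x < M}.Finite) :
    ∃ lam₀ : ℝ, 0 < lam₀ ∧ ∀ lam : ℝ, lam₀ ≤ lam →
      (∃ u : LogKirchhoff.V → ℝ,
        -- a least energy sign-changing solution
        LogKirchhoff.IsSignChangingSolution a b p h lam u ∧
        (∀ φ ∈ LogKirchhoff.HSpace h lam, LogKirchhoff.dJ a b p h lam u φ = 0) ∧
        (∀ v, LogKirchhoff.IsSignChangingSolution a b p h lam v →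
          LogKirchhoff.J a b p h lam u ≤ LogKirchhoff.J a b p h lam v) ∧
        -- which attains the infimum over the sign-changing Nehari set
        u ∈ LogKirchhoff.signNehari a b p h lam ∧
        LogKirchhoff.J a b p h lam u = LogKirchhoff.mLevel a b p h lam) ∧
      -- both infima are genuine
      IsGLB (LogKirchhoff.J a b p h lam '' LogKirchhoff.signNehari a b p h lam)
        (LogKirchhoff.mLevel a b p h lam) ∧
      IsGLB (LogKirchhoff.J a b p h lam '' LogKirchhoff.nehari a b p h lam)
        (LogKirchhoff.cLevel a b p h lam) ∧
      LogKirchhoff.mLevel a b p h lam > 2 * LogKirchhoff.cLevel a b p h lam := by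
  open LogKirchhoff in
  have hp4 : 4 < p := by linarith
  have hp2 : 2 < p := by linarith
  obtain ⟨w₀, E, hE, hw₀⟩ := exists_nodal_in_well ha.le hb.le hp4 h_nonneg h_nontrivial
  obtain ⟨M, hM, hfin⟩ := h_finite
  have hθ := half_sub_inv_pos hp4
  -- This threshold makes (1/2 - 1/p)λM ≥ E + 1, the weight condition of `exists_minimizer` off the
  -- finite set {h < M}.
  refine ⟨(E + 1) / ((1 / 2 - 1 / p) * M), by positivity, fun lam hlam' => ?_⟩
  have hlam : 0 ≤ lam := le_trans (by positivity) hlam'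
  rw [div_le_iff₀ (by positivity)] at hlam'
  obtain ⟨hw₀mem, hw₀E⟩ := hw₀ lam hlam
  obtain ⟨w, hw, hmin⟩ := exists_minimizer ha.le hb.le hp4 hfin.toFinset hw₀mem (by
    intro x hx
    have hx' : M ≤ h x := by simpa using hx
    rw [hw₀E, weight]
    have h1 := mul_le_mul_of_nonneg_left (mul_le_mul_of_nonneg_left hx' hlam) hθ.le
    linarith)
  have hset := signNehari_eq (a := a) (b := b) (p := p) h_nonneg hlam
  have hJ : ∀ {u : V → ℝ}, u ∈ weightedL2 (weight h lam) (one_le_weight h_nonneg hlam) →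
      J a b p h lam u = energy a b p (weight h lam) u := fun hu => J_eq hp2 hu
  have hleast : IsLeast (J a b p h lam '' signNehari a b p h lam) (J a b p h lam w) := by
    rw [hset]
    refine ⟨⟨w, hw, rfl⟩, ?_⟩
    rintro _ ⟨v, hv, rfl⟩
    rw [hJ hw.1, hJ hv.1]
    exact hmin v hv
  have hm : mLevel a b p h lam = J a b p h lam w := hleast.csInf_eq
  have hwS : w ∈ signNehari a b p h lam := hset ▸ hw
  have hcrit : ∀ φ ∈ HSpace h lam, dJ a b p h lam w φ = 0 := by
    intro φ hφ
    rw [mem_HSpace_iff (hρ := one_le_weight h_nonneg hlam) h_nonneg hlam] at hφ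
    rw [dJ_eq hw.1 hφ]
    exact pairing_eq_zero_of_minimizer ha.le hb.le hp4 hw hmin hφ
  obtain ⟨f, g, hf, hg, hf0, hg0, hfN, hgN, hlt⟩ := exists_energy_add_lt ha.le hb hp4 hw
  have hfS : f ∈ nehari a b p h lam := (mem_nehari_iff h_nonneg hlam).2 ⟨hf, hf0, hfN⟩
  have hgS : g ∈ nehari a b p h lam := (mem_nehari_iff h_nonneg hlam).2 ⟨hg, hg0, hgN⟩
  have hbdd : BddBelow (J a b p h lam '' nehari a b p h lam) := by
    refine ⟨0, ?_⟩
    rintro _ ⟨v, hv, rfl⟩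
    obtain ⟨hv, -, hv0⟩ := (mem_nehari_iff h_nonneg hlam).1 hv
    rw [hJ hv]
    exact (mul_nonneg hθ.le (mass_self_nonneg (one_le_weight h_nonneg hlam) v)).trans
      (mass_le_energy ha.le hb.le hp4 hv hv0)
  refine ⟨⟨w, ⟨⟨hwS.1, (isCriticalPoint_iff ha hb.le hp4 h_nonneg hlam hw.1).2 hcrit⟩, hwS.2.1,
    hwS.2.2.1⟩, hcrit, fun v hv => hleast.2 ⟨v, hv.mem_signNehari ha hb.le hp4 h_nonneg hlam, rfl⟩,
    hwS, hm.symm⟩, ?_, isGLB_csInf ⟨_, f, hfS, rfl⟩ hbdd, ?_⟩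
  · rw [hm]
    exact hleast.isGLB
  · have h1 : cLevel a b p h lam ≤ J a b p h lam f := csInf_le hbdd ⟨f, hfS, rfl⟩
    have h2 : cLevel a b p h lam ≤ J a b p h lam g := csInf_le hbdd ⟨g, hgS, rfl⟩
    rw [hJ hf] at h1
    rw [hJ hg] at h2
    rw [hm, hJ hw.1]
    linarith
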